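/- \textbf{Conventions.} Simplicial complexes are finite and contain the empty face; $X(k)$ is the set of $k$-faces of $X$ (faces with $k+1$ vertices, so $X(-1)=\{\emptyset\}$), and $X_z=\{x-z : z\subseteq x\in X\}$ is the link of $X$ at $z\in X$. A \emph{$d$-complex} is a complex of dimension $d$ in which every face is contained in a $d$-face; its canonical weight is $w(x)=\binom{d+1}{k+1}^{-1}\frac{|\{y\in X(d): y\supseteq x\}|}{|X(d)|}$ for $x\in X(k)$ (links carry their own canonical weights). $X$ is \emph{strongly connected} if all its links of dimension at least $1$ (including $X=X_\emptyset$, when $\dim X\ge 1$) are connected. $D(X)$ is the largest number of faces of dimension $\dim X$ containing a vertex. The weighted graph of $X$ is a \emph{$[-1,\lambda]$-spectral expander} if the operator $(\mathcal A f)(x)=\sum_{e\in X(1),\,e\supseteq x}\frac{w(e)}{2w(x)}f(e-x)$ on the space of functions $f:X(0)\to\mathbb R$ with $\sum_{x\in X(0)} w(x)f(x)=0$ has its spectrum in $[-1,\lambda]$; $X$ is an \emph{$i$-local} $[-1,\lambda]$-spectral expander if this holds for $X_z$ for every $z\in X(i)$. An \emph{augmented sheaf} $\mathcal F$ on $X$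 consists of abelian groups $\mathcal F(x)$ ($x\in X$) and homomorphisms $\mathrm{res}_{y\leftarrow x}:\mathcal F(x)\to\mathcal F(y)$ for $x\subsetneq y$ in $X$ with $\mathrm{res}_{z\leftarrow y}\circ\mathrm{res}_{y\leftarrow x}=\mathrm{res}_{z\leftarrow x}$; a \emph{sheaf} is the special case $\mathcal F(\emptyset)=0$. For $z\in X$, $\mathcal F_z$ is the augmented sheaf $\mathcal F_z(x)=\mathcal F(x\cup z)$ on $X_z$. Fix a total order on the vertices; put $C^k=C^k(X,\mathcal F)=\prod_{x\in X(k)}\mathcal F(x)$, and let $d_k:C^k\to C^{k+1}$ be $(d_kf)(\{v_0<\dots<v_{k+1}\})=\sum_{i}(-1)^i\,\mathrm{res}\, f(\{v_0,\dots,v_{k+1}\}-\{v_i\})$. Equivalently, $C^k$ consists of the alternating cochains on ordered faces, and $f(x)$ stands for the value at $x$ with increasing order. Put $Z^k=\ker d_k$, $B^k=\operatorname{im} d_{k-1}$ (with $B^{-1}=0$), $\|f\|=\sum_{x\in X(k),\,f(x)\neq0}w(x)$ for $f\in C^k$, $\|f+H\|=\inf_{h\in H}\|f+h\|$ for a subgroup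 $H\subseteq C^k$, and $m(k)=\sum_{x\in X(k),\,\mathcal F(x)\ne0}w(x)$. $(X,\mathcal F)$ is an \emph{$\varepsilon$-coboundary expander in dimension $k$} if $\|d_kf\|\,m(k)\ge\varepsilon\|f+B^k\|\,m(k+1)$ for all $f\in C^k$. It is an \emph{$(\varepsilon,\delta)$-cosystolic expander in dimension $k$} if $\|d_kf\|\,m(k)\ge\varepsilon\|f+Z^k\|\,m(k+1)$ for all $f\in C^k$, and $\|f\|\ge\delta\, m(k)$ for all $f\in Z^k-B^k$. It is an \emph{$i$-local $\varepsilon$-coboundary expander in dimension $k$} if $(X_z,\mathcal F_z)$ is an $\varepsilon$-coboundary expander in dimension $k-i-1$ for all $z\in X(i)$. For $z\in X(i)$ and $g\in C^{k-i-2}(X_z,\mathcal F_z)$ let $g^z\in C^{k-1}(X,\mathcal F)$ be the cochain that vanishes at the faces not containing $z$ and whose value at the ordered face $xz$ (the vertices of $x$ followed by those of $z$) is $g(x)$. A cochain $f\in C^k$ is \emph{locally minimal} if $\|f+d_{k-1}(g^z)\|\ge\|f\|$ for all $0\le i\le k-1$, $z\in X(i)$ and $g\in C^{k-i-2}(X_z,\mathcal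 F_z)$. $(X,\mathcal F)$ \emph{$\beta$-expands $\alpha$-small locally minimal $k$-cochains} if $\|d_kf\|\ge\beta\|f\|$ for every locally minimal $f\in C^k$ with $\|f\|<\alpha$. \textbf{Theorem.} Let $k\ge0$ and $Q\geq 0$ be integers, and let $\varepsilon_0,\dots,\varepsilon_k,\varepsilon'_0,\dots,\varepsilon'_{k+1},\lambda$ be positive real numbers. Put $$\varepsilon=\min_{0\le i\le k}\frac{(k+2)\varepsilon_i}{k+1-i},\qquad \varepsilon'=\min_{0\le i\le k+1}\frac{(k+3)\varepsilon'_i}{k+2-i}.$$ Let $X$ be a strongly connected $d$-complex with $d\ge k+2$ and let $\mathcal F$ be an augmented sheaf (for example, a sheaf) on $X$. Suppose that $$\lambda\le\frac1d\min\left\{\Big(\frac{\varepsilon}{(k+1)^22^{2k+6}}\Big)^{2^k},\Big(\frac{\varepsilon'}{(k+2)^22^{2k+8}}\Big)^{2^{k+1}},1\right\}$$ and that (1) $(X,\mathcal F)$ is an $i$-local $\varepsilon_i$-coboundary expander in dimension $k$ for all $i\in\{0,\dots,k\}$; (2) $(X,\mathcal F)$ is an $i$-local $\varepsilon'_i$-coboundary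 expander in dimension $k+1$ for all $i\in\{0,\dots,k+1\}$; (3) $X$ is a $(d-2)$-local $[-1,\lambda]$-spectral expander; (4) $D(X)\le Q$; (5) $\mathcal F(x)\ne0$ for all $x\in X(k)\cup X(k+1)\cup X(k+2)$. Then: (i) $(X,\mathcal F)$ $\frac{\varepsilon}{2}$-expands $\big(\frac{\varepsilon}{(k+1)^22^{2k+6}}\big)^{2^{k+1}-1}$-small locally minimal $k$-cochains; (ii) $(X,\mathcal F)$ $\frac{\varepsilon'}{2}$-expands $\big(\frac{\varepsilon'}{(k+2)^22^{2k+8}}\big)^{2^{k+2}-1}$-small locally minimal $(k+1)$-cochains; (iii) $(X,\mathcal F)$ is a $\Big(\min\Big\{\big(\frac{\varepsilon'}{(k+2)^22^{2k+8}}\big)^{2^{k+2}-1},\ \frac{d+1}{(k+1)Q}\binom{d+1}{k+2}^{-1}\Big\},\ \big(\frac{\varepsilon}{(k+1)^22^{2k+6}}\big)^{2^{k+1}-1}\Big)$-cosystolic expander in dimension $k$. -/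

import Mathlib

universe u v

noncomputable section

/-- A finite simplicial complex with vertices in `V`. The empty set is a face. Not every element
of `V` has to be a vertex: the vertices are the `v` such that `{v}` is a face. -/
structure FinComplex (V : Type u) where
  faces : Finset (Finset V)
  empty_mem : ∅ ∈ faces
  down_closed : ∀ {x y : Finset V}, y ∈ faces → x ⊆ y → x ∈ faces

namespace FinComplex

variable {V : Type u} [LinearOrder V]

/-- The faces of `X`, including the empty one. -/
abbrev Face (X : FinComplex V) : Type u := {x : Finset V // x ∈ X.faces}

/-- The dimension of a face: the number of its vertices minus one. -/
def Face.dim {X : FinComplex V} (x : X.Face) : ℤ := (x.1.card : ℤ) - 1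

/-- The dimension of a complex: the largest dimension of a face. -/
def dim (X : FinComplex V) : ℤ := ((X.faces.sup Finset.card : ℕ) : ℤ) - 1

/-- `X(k)`, the set of `k`-faces. -/
def cells (X : FinComplex V) (k : ℤ) : Finset X.Face := {x : X.Face | x.dim = k}

/-- `X` is a `d`-complex: it is of dimension `d`, and every face lies in a `d`-face. -/
def IsPure (X : FinComplex V) (d : ℕ) : Prop :=
  X.dim = d ∧ ∀ x : X.Face, ∃ y ∈ X.cells d, x.1 ⊆ y.1

/-- The degree `D(X)`: the largest number of faces of top dimension that contain a fixed `0`-face. -/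
def degree (X : FinComplex V) : ℕ :=
  (X.cells 0).sup fun x => ((X.cells X.dim).filter fun y => x.1 ⊆ y.1).card

/-- The link `X_z` of `X` at the face `z`. -/
def link (X : FinComplex V) (z : X.Face) : FinComplex V where
  faces := {x ∈ X.faces | Disjoint x z.1 ∧ x ∪ z.1 ∈ X.faces}
  empty_mem := by
    rw [Finset.mem_filter, Finset.empty_union]
    exact ⟨X.empty_mem, Finset.disjoint_empty_left _, z.2⟩
  down_closed := by
    intro x y hy hxy
    rw [Finset.mem_filter] at hy ⊢
    exact ⟨X.down_closed hy.1 hxy, hy.2.1.mono_left hxy,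
      X.down_closed hy.2.2 (Finset.union_subset_union_left hxy)⟩

/-- The face `x ∪ z` of `X` attached to a face `x` of the link `X_z`. -/
def unlink {X : FinComplex V} {z : X.Face} (x : (X.link z).Face) : X.Face :=
  ⟨x.1 ∪ z.1, (Finset.mem_filter.mp x.2).2.2⟩

lemma unlink_ssubset {X : FinComplex V} {z : X.Face} {x y : (X.link z).Face} (h : x.1 ⊂ y.1) :
    (unlink x).1 ⊂ (unlink y).1 := by
  have hy : Disjoint y.1 z.1 := (Finset.mem_filter.mp y.2).2.1
  refine ⟨Finset.union_subset_union_left h.1, fun hle => h.2 fun a ha => ?_⟩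
  rcases Finset.mem_union.mp (hle (Finset.mem_union_left _ ha)) with h1 | h1
  · exact h1
  · exact absurd h1 (Finset.disjoint_left.mp hy ha)

/-- The vertices of `X`. -/
abbrev Vert (X : FinComplex V) : Type u := {a : V // {a} ∈ X.faces}

/-- The `0`-face at a vertex. -/
def vertFace (X : FinComplex V) (a : X.Vert) : X.Face := ⟨{a.1}, a.2⟩

instance (X : FinComplex V) : Fintype X.Vert :=
  Fintype.ofInjective X.vertFace fun a b h => by
    have h1 : ({a.1} : Finset V) = {b.1} := congrArg Subtype.val h
    exact Subtype.ext (Finset.singleton_injective h1)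

/-- The underlying graph of `X`. -/
def graph (X : FinComplex V) : SimpleGraph X.Vert where
  Adj a b := a ≠ b ∧ ({a.1, b.1} : Finset V) ∈ X.faces
  symm := ⟨fun a b h => ⟨h.1.symm, by rw [Finset.pair_comm]; exact h.2⟩⟩
  loopless := ⟨fun _ h => h.1 rfl⟩

/-- `X` is strongly connected: all its links of dimension at least `1` are connected. (This includes
the link `X` of the empty face if `X` is of dimension at least `1`. The links of dimension `0` are
sets of points.) -/
def StronglyConnected (X : FinComplex V) : Prop :=
  ∀ z : X.Face, 1 ≤ (X.link z).dim → (X.link z).graph.Connected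

/-- The canonical weight of a face `x` of a `d`-complex: the number of `d`-faces containing `x`,
divided by the number of `d`-faces and by `(d + 1).choose (dim x + 1)`. -/
def weight (X : FinComplex V) (x : X.Face) : ℝ :=
  (((X.faces.sup Finset.card).choose x.1.card : ℕ) : ℝ)⁻¹ * ((X.cells X.dim).card : ℝ)⁻¹ *
    (((X.cells X.dim).filter fun y => x.1 ⊆ y.1).card : ℝ)

open Classical in
/-- The weighted adjacency operator: the value of `adj f` at a vertex `a` is the sum, over the edges
`{a, b}`, of `w {a, b} / (2 * w {a}) * f b`. -/
def adj (X : FinComplex V) : (X.Vert → ℝ) →ₗ[ℝ] (X.Vert → ℝ) where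
  toFun f := fun a => ∑ b : X.Vert,
    if h : X.graph.Adj a b then
      X.weight ⟨{a.1, b.1}, h.2⟩ / (2 * X.weight (X.vertFace a)) * f b
    else 0
  map_add' f g := by
    funext a
    simp only [Pi.add_apply, ← Finset.sum_add_distrib]
    refine Finset.sum_congr rfl fun b _ => ?_
    split_ifs <;> ring
  map_smul' c f := by
    funext a
    simp only [Pi.smul_apply, smul_eq_mul, RingHom.id_apply, Finset.mul_sum]
    refine Finset.sum_congr rfl fun b _ => ?_
    split_ifs <;> ring

/-- The underlying weighted graph of `X` is a `[-1, lam]`-spectral expander: the spectrum of the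
weighted adjacency operator on the (invariant) space of functions `f` with `∑ a, w {a} * f a = 0`,
that is, the set of its eigenvalues with an eigenvector in this space, lies in `[-1, lam]`. -/
def IsSpectralExpander (X : FinComplex V) (lam : ℝ) : Prop :=
  ∀ (μ : ℝ) (f : X.Vert → ℝ), f ≠ 0 → ∑ a, X.weight (X.vertFace a) * f a = 0 →
    X.adj f = μ • f → μ ∈ Set.Icc (-1) lam

/-- `X` is an `i`-local `[-1, lam]`-spectral expander. -/
def IsLocalSpectralExpander (X : FinComplex V) (i : ℤ) (lam : ℝ) : Prop :=
  ∀ z ∈ X.cells i, (X.link z).IsSpectralExpander lam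

end FinComplex

open FinComplex

/-- An augmented sheaf (of abelian groups) on `X`. A sheaf is the same as an augmented sheaf whose
group at the empty face is zero. -/
structure AugSheaf {V : Type u} [LinearOrder V] (X : FinComplex V) where
  sec : X.Face → Type v
  [grp : ∀ x, AddCommGroup (sec x)]
  res : ∀ {x y : X.Face}, x.1 ⊂ y.1 → sec x →+ sec y
  res_res : ∀ {x y z : X.Face} (hxy : x.1 ⊂ y.1) (hyz : y.1 ⊂ z.1) (s : sec x),
    res hyz (res hxy s) = res (hxy.trans hyz) s

attribute [instance] AugSheaf.grp

namespace AugSheaf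

variable {V : Type u} [LinearOrder V] {X : FinComplex V}

/-- The augmented sheaf `F_z` on the link `X_z`, given by `F_z(x) = F(x ∪ z)`. -/
def link (F : AugSheaf.{u, v} X) (z : X.Face) : AugSheaf.{u, v} (X.link z) where
  sec x := F.sec (unlink x)
  res h := F.res (unlink_ssubset h)
  res_res hxy hyz s := F.res_res (unlink_ssubset hxy) (unlink_ssubset hyz) s

/-- The product of the groups `C^k(X, F)` over all `k`, each identified (by means of the order of
the vertices) with the product of the groups `F(x)` over the unordered `k`-faces `x`: the value at
`x` of a cochain is its value at `x` with the vertices in increasing order. -/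
abbrev Cochain (F : AugSheaf.{u, v} X) : Type (max u v) := (x : X.Face) → F.sec x

/-- `C^k(X, F)`: the cochains that vanish at all faces of dimension other than `k`. -/
def C (F : AugSheaf.{u, v} X) (k : ℤ) : AddSubgroup F.Cochain where
  carrier := {f | ∀ x : X.Face, x.dim ≠ k → f x = 0}
  add_mem' hf hg x hx := by simp [hf x hx, hg x hx]
  zero_mem' x _ := rfl
  neg_mem' hf x hx := by simp [hf x hx]

/-- The face of `y` obtained by removing the vertex `a`. -/
def removeVertex (y : X.Face) (a : V) : X.Face :=
  ⟨y.1.erase a, X.down_closed y.2 (Finset.erase_subset a y.1)⟩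

lemma removeVertex_ssubset {y : X.Face} {a : V} (h : a ∈ y.1) : (removeVertex y a).1 ⊂ y.1 :=
  Finset.erase_ssubset h

/-- The coboundary map: if `y = {v_0 < ... < v_n}`, then `(d f)(y)` is the sum of
`(-1)^i * f(y - v_i)|_y`; here `i` is the number of the vertices of `y` smaller than `v_i`. It maps
`C^k(X, F)` to `C^(k+1)(X, F)`. -/
def d (F : AugSheaf.{u, v} X) : F.Cochain →+ F.Cochain where
  toFun f := fun y => ∑ a : {a : V // a ∈ y.1},
    ((-1 : ℤ) ^ (y.1.filter fun b => b < a.1).card) •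
      F.res (removeVertex_ssubset a.2) (f (removeVertex y a.1))
  map_zero' := by
    funext y
    simp
  map_add' f g := by
    funext y
    simp [Finset.sum_add_distrib]

/-- The cocycles `Z^k(X, F)`. -/
def Z (F : AugSheaf.{u, v} X) (k : ℤ) : AddSubgroup F.Cochain := F.C k ⊓ F.d.ker

/-- The coboundaries `B^k(X, F)`. -/
def B (F : AugSheaf.{u, v} X) (k : ℤ) : AddSubgroup F.Cochain := (F.C (k - 1)).map F.d

open Classical in
/-- The weighted support norm on the group `F(x)`. -/
def secNorm (F : AugSheaf.{u, v} X) (x : X.Face) (s : F.sec x) : ℝ :=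
  if s = 0 then 0 else X.weight x

/-- The weighted support norm of a cochain. -/
def norm (F : AugSheaf.{u, v} X) (f : F.Cochain) : ℝ := ∑ x, F.secNorm x (f x)

/-- The seminorm induced by the weighted support norm on the quotient by a subgroup. -/
def quotNorm (F : AugSheaf.{u, v} X) (H : AddSubgroup F.Cochain) (f : F.Cochain) : ℝ :=
  ⨅ b : H, F.norm (f + b.1)

/-- The total mass `m(k)` of the `k`-faces, relative to the weighted support norm. -/
def mass (F : AugSheaf.{u, v} X) (k : ℤ) : ℝ := ∑ x ∈ X.cells k, ⨆ s : F.sec x, F.secNorm x s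

/-- `(X, F)` is an `ε`-coboundary expander in dimension `k`. -/
def IsCoboundaryExpander (F : AugSheaf.{u, v} X) (k : ℤ) (ε : ℝ) : Prop :=
  ∀ f ∈ F.C k, ε * F.quotNorm (F.B k) f * F.mass (k + 1) ≤ F.norm (F.d f) * F.mass k

/-- `(X, F)` is an `(ε, δ)`-cosystolic expander in dimension `k`. -/
def IsCosystolicExpander (F : AugSheaf.{u, v} X) (k : ℤ) (ε δ : ℝ) : Prop :=
  (∀ f ∈ F.C k, ε * F.quotNorm (F.Z k) f * F.mass (k + 1) ≤ F.norm (F.d f) * F.mass k) ∧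
  (∀ f ∈ F.Z k, f ∉ F.B k → δ * F.mass k ≤ F.norm f)

/-- `(X, F)` is an `i`-local `ε`-coboundary expander in dimension `k`. -/
def IsLocalCoboundaryExpander (F : AugSheaf.{u, v} X) (i k : ℤ) (ε : ℝ) : Prop :=
  ∀ z ∈ X.cells i, (F.link z).IsCoboundaryExpander (k - i - 1) ε

/-- The value `g(x)` of a cochain `g` on the link `X_z`, as an element of `F(x ∪ z) = F_z(x)`. -/
def linkValue (F : AugSheaf.{u, v} X) {z : X.Face} (g : (F.link z).Cochain) (x : (X.link z).Face) :
    F.sec (unlink x) := g x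

/-- `G` is the cochain `g^z` on `X` attached to a cochain `g` on the link `X_z`: it vanishes at the
faces not containing `z`, and its value at the ordered face `xz` (`x` followed by `z`) is `g(x)`.
The sign compares the order of `xz` with the increasing order of the vertices of `x ∪ z`. -/
def IsExtension (F : AugSheaf.{u, v} X) (z : X.Face) (g : (F.link z).Cochain) (G : F.Cochain) :
    Prop :=
  (∀ x : (X.link z).Face, G (unlink x) =
    ((-1 : ℤ) ^ ((x.1 ×ˢ z.1).filter fun p => p.2 < p.1).card) • F.linkValue g x) ∧
  ∀ y : X.Face, ¬ z.1 ⊆ y.1 → G y = 0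

/-- The `k`-cochain `f` is locally minimal at `z`. -/
def IsLocallyMinimalAt (F : AugSheaf.{u, v} X) (k : ℤ) (f : F.Cochain) (z : X.Face) : Prop :=
  ∀ g ∈ (F.link z).C (k - z.dim - 2), ∀ G : F.Cochain, F.IsExtension z g G →
    F.norm f ≤ F.norm (f + F.d G)

/-- The `k`-cochain `f` is locally minimal, that is, at all faces of dimensions `0, ..., k - 1`. -/
def IsLocallyMinimal (F : AugSheaf.{u, v} X) (k : ℤ) (f : F.Cochain) : Prop :=
  ∀ z : X.Face, 0 ≤ z.dim → z.dim ≤ k - 1 → F.IsLocallyMinimalAt k f z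

/-- `(X, F)` `β`-expands `α`-small locally minimal `k`-cochains. -/
def Expands (F : AugSheaf.{u, v} X) (k : ℤ) (β α : ℝ) : Prop :=
  ∀ f ∈ F.C k, F.IsLocallyMinimal k f → F.norm f < α → β * F.norm f ≤ F.norm (F.d f)

end AugSheaf

end

/-! The core is (i); (ii) is the same statement one dimension up, and (iii) follows from both.

Spectral input. Oppenheim's trickling down (`IsPureCard.specLE_of_link`, iterated in
`IsPureCard.formLE_link`) carries the eigenvalue bound from the links of dimension 1 to all links of
dimension at least 1, with `lam` replaced by some `m` satisfying `d * lam ≤ m ≤ 1`. Hence a set of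
link vertices of small measure spans few edges (`FormLE.sum_sum_le`).

Expansion of small locally minimal cochains (`expands_of_link`). Let `S` be the support of `f` and
`K = k + 1`. Call the members of `S` fat; going down one dimension at a time, a face is fat if a
proportion at least `c ^ (2 ^ r)` of the faces just above it is fat. If `f` is small, the empty face
is not fat. A clash is the union of two fat faces meeting in a face of one dimension less that is
not fat. At such a face the fat directions form a small set in its link, so clashes are rare, and
the `k + 1`-faces containing one have weight at most a small multiple of the norm of `f`
(`IsPureCard.sum_bad_le`). Inside any other `k + 1`-face the descent through fat faces is confluent:
all faces of `S` in it descend to one and the same terminal fat face.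

Let `f_z` be the part of `f` on the faces that descend to the terminal face `z`. It lives over the
nonempty face `z`, so local minimality and coboundary expansion of the link give `e * ‖f_z‖ ≤ ‖d
f_z‖` (`IsLocallyMinimalAt.le_norm_d`). The parts cover `f`, and away from the bad faces their
coboundaries do not interfere, so the norms of the `d f_z` add up to at most `‖d f‖` plus a small
multiple of `‖f‖` (`sum_norm_d_ladderPart_le`).

Cosystolic expansion. A shortest representative of a class of cocycles is locally minimal, so if
small it vanishes (`Expands.le_norm_of_mem_Z`). For a `k`-cochain `f` with `d f` small, `d f` is
made locally minimal by adding some `d h`; every correction lowers a norm with discrete values, and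
the degree bound controls its cost. The result is a small locally minimal cocycle, hence zero, so `f
+ h` is a cocycle near `f` (`Expands.quotNorm_Z_le`). -/

set_option linter.unusedSectionVars false

open FinComplex

/-! ### Canonical weights of pure complexes and of their links. -/

namespace FinComplex

variable {V : Type u} [LinearOrder V]

/-- All maximal faces of `X` have `n` vertices. -/
structure IsPureCard (X : FinComplex V) (n : ℕ) : Prop where
  sup_card : X.faces.sup Finset.card = n
  exists_facet : ∀ x ∈ X.faces, ∃ t ∈ X.faces, t.card = n ∧ x ⊆ t

/-- The faces of top dimension, as sets of vertices. -/
def facets (X : FinComplex V) : Finset (Finset V) :=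
  {t ∈ X.faces | t.card = X.faces.sup Finset.card}

/-- The canonical weight, extended by zero to all finite sets of vertices. -/
noncomputable def wt (X : FinComplex V) (s : Finset V) : ℝ :=
  (((X.faces.sup Finset.card).choose s.card : ℕ) : ℝ)⁻¹ * (X.facets.card : ℝ)⁻¹ *
    ((X.facets.filter fun t => s ⊆ t).card : ℝ)

lemma mem_cells_int {X : FinComplex V} {x : X.Face} {j : ℤ} :
    x ∈ X.cells j ↔ (x.1.card : ℤ) = j + 1 := by
  rw [cells, Finset.mem_filter, Face.dim]
  simp only [Finset.mem_univ, true_and]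
  omega

lemma mem_cells {X : FinComplex V} {x : X.Face} {j : ℕ} : x ∈ X.cells j ↔ x.1.card = j + 1 := by
  rw [mem_cells_int]
  omega

lemma card_cells_dim_filter (X : FinComplex V) (s : Finset V) :
    ((X.cells X.dim).filter fun y => s ⊆ y.1).card = (X.facets.filter fun t => s ⊆ t).card := by
  refine Finset.card_bij (fun y _ => y.1) ?_ (fun a _ b _ h => Subtype.ext h) ?_
  · intro y hy
    rw [Finset.mem_filter, mem_cells_int, dim] at hy
    simp only [facets, Finset.mem_filter]
    exact ⟨⟨y.2, by have := hy.1; omega⟩, hy.2⟩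
  · intro t ht
    simp only [facets, Finset.mem_filter] at ht
    refine ⟨⟨t, ht.1.1⟩, ?_, rfl⟩
    rw [Finset.mem_filter, mem_cells_int, dim]
    exact ⟨by simp [ht.1.2], ht.2⟩

lemma card_cells_dim (X : FinComplex V) : (X.cells X.dim).card = X.facets.card := by
  simpa using X.card_cells_dim_filter ∅

lemma weight_eq_wt (X : FinComplex V) (x : X.Face) : X.weight x = X.wt x.1 := by
  rw [weight, wt, card_cells_dim, card_cells_dim_filter]

lemma wt_nonneg (X : FinComplex V) (s : Finset V) : 0 ≤ X.wt s := by
  unfold wt; positivity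

lemma wt_eq_zero (X : FinComplex V) {s : Finset V} (hs : s ∉ X.faces) : X.wt s = 0 := by
  have : (X.facets.filter fun t => s ⊆ t) = ∅ := by
    refine Finset.filter_eq_empty_iff.mpr fun t ht hst => hs ?_
    exact X.down_closed (Finset.mem_filter.mp ht).1 hst
  rw [wt, this]; simp

lemma IsPure.isPureCard {X : FinComplex V} {d : ℕ} (h : X.IsPure d) : X.IsPureCard (d + 1) := by
  refine ⟨by have := h.1; unfold dim at this; omega, fun x hx => ?_⟩
  obtain ⟨y, hy, hxy⟩ := h.2 ⟨x, hx⟩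
  exact ⟨y.1, y.2, mem_cells.mp hy, hxy⟩

namespace IsPureCard

variable {X : FinComplex V} {n : ℕ}

lemma mem_facets (h : X.IsPureCard n) {t : Finset V} :
    t ∈ X.facets ↔ t ∈ X.faces ∧ t.card = n := by
  rw [facets, Finset.mem_filter, h.sup_card]

lemma card_le (h : X.IsPureCard n) {x : Finset V} (hx : x ∈ X.faces) : x.card ≤ n :=
  h.sup_card ▸ Finset.le_sup (f := Finset.card) hx

lemma card_facets_pos (h : X.IsPureCard n) : 0 < X.facets.card := by
  obtain ⟨t, ht, hc, -⟩ := h.exists_facet ∅ X.empty_mem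
  exact Finset.card_pos.mpr ⟨t, h.mem_facets.mpr ⟨ht, hc⟩⟩

lemma card_filter_pos (h : X.IsPureCard n) {x : Finset V} (hx : x ∈ X.faces) :
    0 < (X.facets.filter fun t => x ⊆ t).card := by
  obtain ⟨t, ht, hc, hxt⟩ := h.exists_facet x hx
  exact Finset.card_pos.mpr ⟨t, Finset.mem_filter.mpr ⟨h.mem_facets.mpr ⟨ht, hc⟩, hxt⟩⟩

lemma wt_eq (h : X.IsPureCard n) (s : Finset V) : X.wt s = ((n.choose s.card : ℕ) : ℝ)⁻¹ *
    (X.facets.card : ℝ)⁻¹ * ((X.facets.filter fun t => s ⊆ t).card : ℝ) := by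
  rw [wt, h.sup_card]

lemma choose_pos (h : X.IsPureCard n) {x : Finset V} (hx : x ∈ X.faces) :
    0 < n.choose x.card := Nat.choose_pos (h.card_le hx)

lemma wt_pos (h : X.IsPureCard n) {x : Finset V} (hx : x ∈ X.faces) : 0 < X.wt x := by
  have h1 := h.card_facets_pos
  have h2 := h.card_filter_pos hx
  have h3 := h.choose_pos hx
  rw [h.wt_eq]
  positivity

lemma wt_empty (h : X.IsPureCard n) : X.wt ∅ = 1 := by
  have := h.card_facets_pos
  rw [h.wt_eq]
  simp only [Finset.card_empty, Nat.choose_zero_right, Nat.cast_one, inv_one, one_mul,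
    Finset.empty_subset, Finset.filter_true]
  exact inv_mul_cancel₀ (by positivity)

lemma card_between {x t : Finset V} (hxt : x ⊆ t) {j : ℕ} (hj : x.card ≤ j) :
    ((t.powersetCard j).filter fun y => x ⊆ y).card = (t.card - x.card).choose (j - x.card) := by
  rw [← Finset.card_sdiff_of_subset hxt, ← Finset.card_powersetCard]
  refine Finset.card_bij (fun y _ => y \ x) ?_ ?_ ?_
  · intro y hy
    simp only [Finset.mem_filter, Finset.mem_powersetCard] at hy ⊢
    exact ⟨Finset.sdiff_subset_sdiff hy.1.1 le_rfl, by
      rw [Finset.card_sdiff_of_subset hy.2, hy.1.2]⟩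
  · intro a ha b hb hab
    simp only [Finset.mem_filter] at ha hb
    rw [← Finset.sdiff_union_of_subset ha.2, hab, Finset.sdiff_union_of_subset hb.2]
  · intro y hy
    simp only [Finset.mem_powersetCard] at hy
    have hd : Disjoint y x := Finset.disjoint_of_subset_left hy.1 Finset.sdiff_disjoint
    refine ⟨y ∪ x, ?_, Finset.union_sdiff_cancel_right hd⟩
    simp only [Finset.mem_filter, Finset.mem_powersetCard]
    exact ⟨⟨Finset.union_subset (hy.1.trans Finset.sdiff_subset) hxt, by
      rw [Finset.card_union_of_disjoint hd]; omega⟩, Finset.subset_union_right⟩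

/-- The `j`-element faces containing `x` have total weight `j.choose |x| * w(x)`. -/
lemma sum_wt (h : X.IsPureCard n) (x : Finset V) {j : ℕ} (hj : x.card ≤ j) (hjn : j ≤ n) :
    ∑ y ∈ X.faces with y.card = j ∧ x ⊆ y, X.wt y = (j.choose x.card : ℕ) * X.wt x := by
  -- Double counting of the pairs `x ⊆ y ⊆ t` with `t` a facet.
  have key : ∑ y ∈ X.faces with y.card = j ∧ x ⊆ y, (X.facets.filter fun t => y ⊆ t).card =
      (n - x.card).choose (j - x.card) * (X.facets.filter fun t => x ⊆ t).card := by
    refine (Finset.sum_card_bipartiteAbove_eq_sum_card_bipartiteBelow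
      (fun y t : Finset V => y ⊆ t)).trans ?_
    rw [← Finset.sum_subset (Finset.filter_subset (fun t => x ⊆ t) X.facets)]
    · rw [mul_comm, ← smul_eq_mul, ← Finset.sum_const]
      refine Finset.sum_congr rfl fun t ht => ?_
      rw [Finset.mem_filter, h.mem_facets] at ht
      rw [← ht.1.2, ← card_between ht.2 hj]
      congr 1
      ext y
      simp only [Finset.bipartiteBelow, Finset.mem_filter, Finset.mem_powersetCard]
      constructor
      · rintro ⟨⟨_, h1, h2⟩, h3⟩; exact ⟨⟨h3, h1⟩, h2⟩
      · rintro ⟨⟨h3, h1⟩, h2⟩; exact ⟨⟨X.down_closed ht.1.1 h3, h1, h2⟩, h3⟩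
    · intro t ht hxt
      rw [Finset.card_eq_zero, Finset.bipartiteBelow, Finset.filter_eq_empty_iff]
      intro y hy hyt
      rw [Finset.mem_filter] at hy
      exact hxt (Finset.mem_filter.mpr ⟨ht, hy.2.2.trans hyt⟩)
  have hch : ((n.choose j : ℕ) : ℝ) * (j.choose x.card : ℕ) =
      (n.choose x.card : ℕ) * ((n - x.card).choose (j - x.card) : ℕ) := by
    exact_mod_cast Nat.choose_mul hj
  have h1 : (0 : ℝ) < (n.choose j : ℕ) := by exact_mod_cast Nat.choose_pos hjn
  have h2 : (0 : ℝ) < (n.choose x.card : ℕ) := by exact_mod_cast Nat.choose_pos (hj.trans hjn)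
  have hsum : ∑ y ∈ X.faces with y.card = j ∧ x ⊆ y, X.wt y =
      ((n.choose j : ℕ) : ℝ)⁻¹ * (X.facets.card : ℝ)⁻¹ *
        ((∑ y ∈ X.faces with y.card = j ∧ x ⊆ y, (X.facets.filter fun t => y ⊆ t).card : ℕ) :
          ℝ) := by
    rw [Nat.cast_sum, Finset.mul_sum]
    refine Finset.sum_congr rfl fun y hy => ?_
    rw [h.wt_eq, (Finset.mem_filter.mp hy).2.1]
  rw [hsum, key, h.wt_eq, Nat.cast_mul]
  have h3 : (((n - x.card).choose (j - x.card) : ℕ) : ℝ) =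
      (n.choose j : ℕ) * (j.choose x.card : ℕ) * ((n.choose x.card : ℕ) : ℝ)⁻¹ := by
    rw [hch]; field_simp
  rw [h3]
  generalize ((j.choose x.card : ℕ) : ℝ) = a at *
  generalize ((n.choose j : ℕ) : ℝ) = b at *
  generalize ((n.choose x.card : ℕ) : ℝ) = c at *
  linear_combination (a * c⁻¹ * (X.facets.card : ℝ)⁻¹ *
    ((X.facets.filter fun t => x ⊆ t).card : ℝ)) * inv_mul_cancel₀ h1.ne'

lemma sum_wt_card (h : X.IsPureCard n) {j : ℕ} (hjn : j ≤ n) :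
    ∑ y ∈ X.faces with y.card = j, X.wt y = 1 := by
  have := h.sum_wt ∅ (Nat.zero_le j) hjn
  simp only [Finset.empty_subset, and_true, h.wt_empty, mul_one, Finset.card_empty,
    Nat.choose_zero_right, Nat.cast_one] at this
  exact this

end IsPureCard

lemma mem_link {X : FinComplex V} {z : X.Face} {x : Finset V} :
    x ∈ (X.link z).faces ↔ Disjoint x z.1 ∧ x ∪ z.1 ∈ X.faces := by
  simp only [link, Finset.mem_filter]
  exact ⟨fun h => h.2, fun h => ⟨X.down_closed h.2 Finset.subset_union_left, h⟩⟩

lemma disjoint_of_mem_link {X : FinComplex V} {z : X.Face} {x : Finset V}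
    (hx : x ∈ (X.link z).faces) : Disjoint x z.1 := (mem_link.mp hx).1

lemma unlink_injective {X : FinComplex V} {z : X.Face} :
    Function.Injective (unlink : (X.link z).Face → X.Face) := by
  intro x y hxy
  have h : x.1 ∪ z.1 = y.1 ∪ z.1 := congrArg Subtype.val hxy
  apply Subtype.ext
  rw [← Finset.union_sdiff_cancel_right (disjoint_of_mem_link x.2), h,
    Finset.union_sdiff_cancel_right (disjoint_of_mem_link y.2)]

lemma exists_unlink {X : FinComplex V} {z : X.Face} {y : X.Face} (h : z.1 ⊆ y.1) :
    ∃ x : (X.link z).Face, unlink x = y :=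
  ⟨⟨y.1 \ z.1, mem_link.mpr ⟨Finset.sdiff_disjoint, by
    rw [Finset.sdiff_union_of_subset h]; exact y.2⟩⟩,
    Subtype.ext (Finset.sdiff_union_of_subset h)⟩

lemma card_unlink {X : FinComplex V} {z : X.Face} (x : (X.link z).Face) :
    (unlink x).1.card = x.1.card + z.1.card :=
  Finset.card_union_of_disjoint (disjoint_of_mem_link x.2)

lemma sdiff_mem_link {X : FinComplex V} {z : X.Face} {t : Finset V} (ht : t ∈ X.faces)
    (hzt : z.1 ⊆ t) : t \ z.1 ∈ (X.link z).faces :=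
  mem_link.mpr ⟨Finset.sdiff_disjoint, by rwa [Finset.sdiff_union_of_subset hzt]⟩

lemma IsPureCard.link {X : FinComplex V} {n : ℕ} (h : X.IsPureCard n) (z : X.Face) :
    (X.link z).IsPureCard (n - z.1.card) := by
  have hle : ∀ x ∈ (X.link z).faces, x.card ≤ n - z.1.card := by
    intro x hx
    have := h.card_le (mem_link.mp hx).2
    rw [Finset.card_union_of_disjoint (disjoint_of_mem_link hx)] at this
    omega
  have hex : ∀ x ∈ (X.link z).faces, ∃ t ∈ (X.link z).faces, t.card = n - z.1.card ∧ x ⊆ t := by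
    intro x hx
    obtain ⟨t, ht, hc, hxt⟩ := h.exists_facet _ (mem_link.mp hx).2
    have hzt : z.1 ⊆ t := Finset.subset_union_right.trans hxt
    refine ⟨t \ z.1, sdiff_mem_link ht hzt, by rw [Finset.card_sdiff_of_subset hzt, hc], ?_⟩
    exact Finset.subset_sdiff.mpr ⟨Finset.subset_union_left.trans hxt, disjoint_of_mem_link hx⟩
  refine ⟨le_antisymm (Finset.sup_le hle) ?_, hex⟩
  obtain ⟨t, ht, hc, -⟩ := hex ∅ (X.link z).empty_mem
  exact hc ▸ Finset.le_sup (f := Finset.card) ht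

lemma IsPureCard.card_facets_link {X : FinComplex V} {n : ℕ} (h : X.IsPureCard n) (z : X.Face)
    {s : Finset V} (hs : Disjoint s z.1) :
    ((X.link z).facets.filter fun t => s ⊆ t).card =
      (X.facets.filter fun t => s ∪ z.1 ⊆ t).card := by
  have hz := h.card_le z.2
  refine Finset.card_bij (fun t _ => t ∪ z.1) ?_ ?_ ?_
  · intro t ht
    rw [Finset.mem_filter, (h.link z).mem_facets] at ht
    rw [Finset.mem_filter, h.mem_facets]
    refine ⟨⟨(mem_link.mp ht.1.1).2, ?_⟩, Finset.union_subset_union_left ht.2⟩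
    rw [Finset.card_union_of_disjoint (disjoint_of_mem_link ht.1.1)]
    omega
  · intro a ha b hb hab
    rw [Finset.mem_filter, (h.link z).mem_facets] at ha hb
    exact congrArg Subtype.val
      (@unlink_injective _ _ X z ⟨a, ha.1.1⟩ ⟨b, hb.1.1⟩ (Subtype.ext hab))
  · intro t ht
    rw [Finset.mem_filter, h.mem_facets] at ht
    have hzt : z.1 ⊆ t := Finset.subset_union_right.trans ht.2
    refine ⟨t \ z.1, ?_, Finset.sdiff_union_of_subset hzt⟩
    rw [Finset.mem_filter, (h.link z).mem_facets]
    exact ⟨⟨sdiff_mem_link ht.1.1 hzt, by rw [Finset.card_sdiff_of_subset hzt, ht.1.2]⟩,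
      Finset.subset_sdiff.mpr ⟨Finset.subset_union_left.trans ht.2, hs⟩⟩

/-- The weights of a complex and of its links. -/
lemma IsPureCard.wt_union {X : FinComplex V} {n : ℕ} (h : X.IsPureCard n) (z : X.Face)
    {s : Finset V} (hs : Disjoint s z.1) :
    X.wt (s ∪ z.1) = ((s.card + z.1.card).choose z.1.card : ℕ) * X.wt z.1 * (X.link z).wt s := by
  by_cases hf : s ∪ z.1 ∈ X.faces
  swap
  · rw [X.wt_eq_zero hf, (X.link z).wt_eq_zero fun h => hf (mem_link.mp h).2, mul_zero]
  have hle := h.card_le hf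
  have hz := h.card_filter_pos z.2
  have hsz := Finset.card_union_of_disjoint hs
  have h0 := h.card_facets_link z (Finset.disjoint_empty_left z.1)
  simp only [Finset.empty_subset, Finset.filter_true, Finset.empty_union] at h0
  rw [h.wt_eq, h.wt_eq, (h.link z).wt_eq, h.card_facets_link z hs, h0, hsz]
  have hch := Nat.choose_mul (n := n) (k := s.card + z.1.card) (s := z.1.card) (by omega)
  rw [Nat.add_sub_cancel] at hch
  have hch' : ((n.choose (s.card + z.1.card) : ℕ) : ℝ) *
      ((s.card + z.1.card).choose z.1.card : ℕ) =
      (n.choose z.1.card : ℕ) * ((n - z.1.card).choose s.card : ℕ) := by exact_mod_cast hch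
  have h1 : (0 : ℝ) < (n.choose (s.card + z.1.card) : ℕ) := by
    exact_mod_cast Nat.choose_pos (by omega)
  have h2 : (0 : ℝ) < (n.choose z.1.card : ℕ) := by exact_mod_cast Nat.choose_pos (by omega)
  have h3 : (0 : ℝ) < ((n - z.1.card).choose s.card : ℕ) := by
    exact_mod_cast Nat.choose_pos (by omega)
  have h4 : (0 : ℝ) < ((X.facets.filter fun t => z.1 ⊆ t).card : ℝ) := by exact_mod_cast hz
  have h5 : (((s.card + z.1.card).choose z.1.card : ℕ) : ℝ) =
      (n.choose z.1.card : ℕ) * ((n - z.1.card).choose s.card : ℕ) *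
        ((n.choose (s.card + z.1.card) : ℕ) : ℝ)⁻¹ := by
    rw [← hch']; field_simp
  rw [h5]
  field_simp

lemma IsPureCard.weight_unlink {X : FinComplex V} {n : ℕ} (h : X.IsPureCard n) {z : X.Face}
    (x : (X.link z).Face) : X.weight (unlink x) =
      ((x.1.card + z.1.card).choose z.1.card : ℕ) * X.weight z * (X.link z).weight x := by
  simp only [weight_eq_wt]
  exact h.wt_union z (disjoint_of_mem_link x.2)

/-- A genuine equality of complexes, since all links live on the same ambient vertex type; trickling
down can therefore rewrite with it. -/
lemma link_link {X : FinComplex V} {z : X.Face} (v : (X.link z).Face) :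
    (X.link z).link v = X.link (unlink v) := by
  have hf : ((X.link z).link v).faces = (X.link (unlink v)).faces := by
    ext x
    rw [mem_link, mem_link, mem_link]
    simp only [unlink, Finset.disjoint_union_left, Finset.disjoint_union_right,
      Finset.union_assoc]
    have := disjoint_of_mem_link v.2
    tauto
  cases h : (X.link z).link v
  cases h' : X.link (unlink v)
  rw [h, h'] at hf
  simp only at hf
  subst hf
  rfl

end FinComplex

/-! ### From eigenvalues to quadratic forms. -/

/-- If the eigenvalues of a reversible random walk with stationary distribution `w`, on functions of
mean zero, are at most `lam`, then so is its quadratic form. -/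
theorem reversible_form_le {ι : Type*} [Fintype ι] (w : ι → ℝ) (W : ι → ι → ℝ) (lam : ℝ)
    (hw : ∀ a, 0 < w a) (hsym : ∀ a b, W a b = W b a) (hdeg : ∀ a, ∑ b, W a b = w a)
    (hone : ∑ a, w a = 1)
    (hspec : ∀ (μ : ℝ) (f : ι → ℝ), f ≠ 0 → ∑ a, w a * f a = 0 →
      (∀ a, ∑ b, W a b / w a * f b = μ * f a) → μ ≤ lam) (f : ι → ℝ) :
    ∑ a, ∑ b, W a b * f a * f b ≤
      lam * ∑ a, w a * f a ^ 2 + (1 - lam) * (∑ a, w a * f a) ^ 2 := by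
  classical
  set s : ι → ℝ := fun a => √(w a) with hs
  have hspos : ∀ a, 0 < s a := fun a => Real.sqrt_pos.mpr (hw a)
  have hss : ∀ a, s a * s a = w a := fun a => Real.mul_self_sqrt (hw a).le
  -- The claim for `f` says that this symmetric matrix has nonnegative quadratic form at the vector
  -- `s * f`. The rank-one term is chosen so that `s` lies in the kernel of `P`.
  set P : Matrix ι ι ℝ := Matrix.of fun a b =>
    (if a = b then lam else 0) - W a b / (s a * s b) + (1 - lam) * (s a * s b) with hP
  have hmul : ∀ (u : ι → ℝ) a, (P.mulVec u) a =
      lam * u a - ∑ b, W a b / (s a * s b) * u b + (1 - lam) * s a * ∑ b, s b * u b := by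
    intro u a
    simp only [Matrix.mulVec, dotProduct, hP, Matrix.of_apply, add_mul, sub_mul,
      Finset.sum_add_distrib, Finset.sum_sub_distrib, ite_mul, zero_mul, Finset.sum_ite_eq,
      Finset.mem_univ, if_true, Finset.mul_sum]
    congr 1
    congr 1 <;> exact Finset.sum_congr rfl fun b _ => by ring
  have hherm : P.IsHermitian := by
    ext a b
    simp only [Matrix.conjTranspose_apply, hP, Matrix.of_apply, star_trivial]
    rw [hsym b a, mul_comm (s b) (s a)]
    simp only [eq_comm]
  have hpsd : P.PosSemidef := by
    rw [hherm.posSemidef_iff_eigenvalues_nonneg]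
    intro i
    simp only [Pi.zero_apply]
    set ν := hherm.eigenvalues i
    set u : ι → ℝ := ⇑(hherm.eigenvectorBasis i) with hu
    have hu0 : u ≠ 0 := by
      intro h0
      have h1 := hherm.eigenvectorBasis.orthonormal.ne_zero i
      exact h1 (by ext j; exact congrFun h0 j)
    have hev : ∀ a, lam * u a - ∑ b, W a b / (s a * s b) * u b +
        (1 - lam) * s a * ∑ b, s b * u b = ν * u a := by
      intro a
      rw [← hmul]
      have := congrFun (hherm.mulVec_eigenvectorBasis i) a
      simpa using this
    -- If the eigenvector `u` is orthogonal to `s`, then `u / s` has mean zero and is an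
    -- eigenfunction of the walk for `lam - ν`. Otherwise pairing the eigenvalue equation with the
    -- kernel vector `s` forces `ν = 0`.
    by_cases hsu : ∑ b, s b * u b = 0
    · have h1 : lam - ν ≤ lam := by
        refine hspec (lam - ν) (fun a => u a / s a) ?_ ?_ ?_
        · intro h0
          apply hu0
          funext a
          have := congrFun h0 a
          simp only [Pi.zero_apply, div_eq_zero_iff] at this
          exact this.resolve_right (hspos a).ne'
        · rw [← hsu]
          refine Finset.sum_congr rfl fun a _ => ?_
          rw [← hss a]
          have := (hspos a).ne'
          field_simp
        · intro a
          have h2 := hev a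
          rw [hsu, mul_zero, add_zero] at h2
          have h3 : (lam - ν) * (u a / s a) = (∑ b, W a b / (s a * s b) * u b) / s a := by
            rw [show ∑ b, W a b / (s a * s b) * u b = (lam - ν) * u a by linarith]
            ring
          rw [h3, Finset.sum_div]
          refine Finset.sum_congr rfl fun b _ => ?_
          rw [← hss a]
          have := (hspos a).ne'
          have := (hspos b).ne'
          field_simp
      linarith
    · have h1 : ν * ∑ a, s a * u a = 0 := by
        have h2 : ∑ a, s a * (ν * u a) = ∑ a, (lam * (s a * u a) -
            ∑ b, W a b / s b * u b + (1 - lam) * w a * ∑ b, s b * u b) := by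
          refine Finset.sum_congr rfl fun a _ => ?_
          rw [← hev a, ← hss a]
          have h3 : ∑ b, W a b / s b * u b = s a * ∑ b, W a b / (s a * s b) * u b := by
            rw [Finset.mul_sum]
            refine Finset.sum_congr rfl fun b _ => ?_
            have := (hspos a).ne'
            have := (hspos b).ne'
            field_simp
          rw [h3]; ring
        have h4 : ∑ a, ∑ b, W a b / s b * u b = ∑ b, s b * u b := by
          rw [Finset.sum_comm]
          refine Finset.sum_congr rfl fun b _ => ?_
          rw [← Finset.sum_mul, ← Finset.sum_div, Finset.sum_congr rfl fun a _ => hsym a b, hdeg,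
            ← hss b]
          have := (hspos b).ne'
          field_simp
        have h5 : ν * ∑ a, s a * u a = ∑ a, s a * (ν * u a) := by
          rw [Finset.mul_sum]
          exact Finset.sum_congr rfl fun a _ => by ring
        rw [h5, h2, Finset.sum_add_distrib, Finset.sum_sub_distrib, h4, ← Finset.mul_sum,
          ← Finset.sum_mul, ← Finset.mul_sum, hone]
        ring
      exact ((mul_eq_zero.mp h1).resolve_right hsu).ge
  have hq := hpsd.dotProduct_mulVec_nonneg (fun a => s a * f a)
  have h6 : ∀ a, star (fun a => s a * f a) a * (P.mulVec fun a => s a * f a) a =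
      lam * (w a * f a ^ 2) - ∑ b, W a b * f a * f b +
        (1 - lam) * (w a * f a) * ∑ b, w b * f b := by
    intro a
    rw [hmul]
    have h7 : ∑ b, W a b / (s a * s b) * (s b * f b) = (∑ b, W a b * f b) / s a := by
      rw [Finset.sum_div]
      refine Finset.sum_congr rfl fun b _ => ?_
      have := (hspos a).ne'
      have := (hspos b).ne'
      field_simp
    have h8 : ∑ b, s b * (s b * f b) = ∑ b, w b * f b :=
      Finset.sum_congr rfl fun b _ => by rw [← hss b]; ring
    have h9 : ∑ b, W a b * f a * f b = f a * ∑ b, W a b * f b := by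
      rw [Finset.mul_sum]
      exact Finset.sum_congr rfl fun b _ => by ring
    rw [h7, h8, h9, ← hss a]
    simp only [Pi.star_apply, star_trivial]
    have := (hspos a).ne'
    field_simp
  rw [dotProduct, Finset.sum_congr rfl fun a _ => h6 a, Finset.sum_add_distrib,
    Finset.sum_sub_distrib, ← Finset.mul_sum, ← Finset.sum_mul, ← Finset.mul_sum] at hq
  linarith

namespace FinComplex

variable {V : Type u} [LinearOrder V]

/-- Half the weight of an edge, extended by zero to all pairs. -/
noncomputable def halfWt (X : FinComplex V) (a b : V) : ℝ := if a = b then 0 else X.wt {a, b} / 2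

lemma halfWt_comm (X : FinComplex V) (a b : V) : X.halfWt a b = X.halfWt b a := by
  simp only [halfWt, eq_comm (a := a), Finset.pair_comm a]

lemma halfWt_nonneg (X : FinComplex V) (a b : V) : 0 ≤ X.halfWt a b := by
  unfold halfWt
  have := X.wt_nonneg {a, b}
  split_ifs <;> positivity

/-- The quadratic form of the adjacency operator is bounded by `lam` on functions of mean zero. -/
def FormLE (X : FinComplex V) (lam : ℝ) : Prop :=
  ∀ (U : Finset V), (∀ x ∈ X.faces, x ⊆ U) → ∀ f : V → ℝ,
    ∑ a ∈ U, ∑ b ∈ U, X.halfWt a b * f a * f b ≤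
      lam * ∑ a ∈ U, X.wt {a} * f a ^ 2 + (1 - lam) * (∑ a ∈ U, X.wt {a} * f a) ^ 2

/-- The eigenvalues of the adjacency operator on functions of mean zero are at most `lam`. -/
def SpecLE (X : FinComplex V) (lam : ℝ) : Prop :=
  ∀ (μ : ℝ) (f : X.Vert → ℝ), f ≠ 0 → ∑ a, X.weight (X.vertFace a) * f a = 0 →
    X.adj f = μ • f → μ ≤ lam

lemma SpecLE.mono {X : FinComplex V} {l l' : ℝ} (h : X.SpecLE l) (hl : l ≤ l') : X.SpecLE l' :=
  fun μ f hf h0 he => (h μ f hf h0 he).trans hl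

lemma IsSpectralExpander.specLE {X : FinComplex V} {l : ℝ} (h : X.IsSpectralExpander l) :
    X.SpecLE l := fun μ f hf h0 he => (h μ f hf h0 he).2

lemma adj_apply (X : FinComplex V) (f : X.Vert → ℝ) (a : X.Vert) :
    X.adj f a = ∑ b : X.Vert, X.halfWt a.1 b.1 / X.wt {a.1} * f b := by
  classical
  simp only [adj, LinearMap.coe_mk, AddHom.coe_mk]
  refine Finset.sum_congr rfl fun b _ => ?_
  split_ifs with h
  · rw [halfWt, if_neg fun h' => h.1 (Subtype.ext h'), weight_eq_wt, weight_eq_wt]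
    simp only [vertFace]
    ring
  · by_cases hab : a.1 = b.1
    · rw [halfWt, if_pos hab]; simp
    · have : ({a.1, b.1} : Finset V) ∉ X.faces := fun h' => h ⟨fun h'' => hab (h'' ▸ rfl), h'⟩
      rw [halfWt, if_neg hab, X.wt_eq_zero this]; simp

/-- Replaces the vertex subtype by an ambient set `U` that serves the complex and all its links at
once, so that sums over different links can be interchanged. -/
lemma sum_vert (X : FinComplex V) {U : Finset V} (hU : ∀ x ∈ X.faces, x ⊆ U) (g : V → ℝ)
    (hg : ∀ a, {a} ∉ X.faces → g a = 0) : ∑ a : X.Vert, g a.1 = ∑ a ∈ U, g a := by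
  classical
  rw [← Finset.sum_filter_of_ne (p := fun a => {a} ∈ X.faces) fun a _ ha => by
    by_contra h; exact ha (hg a h)]
  refine Finset.sum_bij (fun a _ => a.1) ?_ (fun a _ b _ h => Subtype.ext h) ?_ (fun _ _ => rfl)
  · intro a _
    exact Finset.mem_filter.mpr ⟨hU _ a.2 (Finset.mem_singleton_self _), a.2⟩
  · intro a ha
    exact ⟨⟨a, (Finset.mem_filter.mp ha).2⟩, Finset.mem_univ _, rfl⟩

namespace IsPureCard

variable {X : FinComplex V} {n : ℕ}

lemma sum_wt_insert (h : X.IsPureCard n) {U : Finset V} (hU : ∀ x ∈ X.faces, x ⊆ U)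
    (x : Finset V) (hx : x.card + 1 ≤ n) :
    ∑ v ∈ U, (if v ∈ x then 0 else X.wt (insert v x)) = (x.card + 1 : ℝ) * X.wt x := by
  have h1 := h.sum_wt x (Nat.le_succ x.card) hx
  rw [Nat.choose_succ_self_right, Nat.cast_add, Nat.cast_one] at h1
  rw [← h1]
  symm
  rw [← Finset.sum_filter_ne_zero (s := U)]
  symm
  refine Finset.sum_bij (fun v _ => insert v x) ?_ ?_ ?_ ?_
  · intro v hv
    rw [Finset.mem_filter] at hv
    by_cases hvx : v ∈ x
    · simp [hvx] at hv
    · rw [if_neg hvx] at hv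
      refine Finset.mem_filter.mpr ⟨?_, Finset.card_insert_of_notMem hvx,
        Finset.subset_insert _ _⟩
      by_contra hf
      exact hv.2 (X.wt_eq_zero hf)
  · intro a ha b hb hab
    rw [Finset.mem_filter] at ha hb
    have hax : a ∉ x := fun h' => ha.2 (by rw [if_pos h'])
    have : a ∈ insert b x := hab ▸ Finset.mem_insert_self a x
    exact (Finset.mem_insert.mp this).resolve_right hax
  · intro y hy
    rw [Finset.mem_filter] at hy
    have hc : (y \ x).card = 1 := by rw [Finset.card_sdiff_of_subset hy.2.2, hy.2.1]; omega
    obtain ⟨v, hv⟩ := Finset.card_eq_one.mp hc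
    have hv1 : v ∈ y \ x := hv ▸ Finset.mem_singleton_self v
    rw [Finset.mem_sdiff] at hv1
    have hy' : insert v x = y := by
      rw [Finset.insert_eq, ← hv, Finset.sdiff_union_of_subset hy.2.2]
    refine ⟨v, Finset.mem_filter.mpr ⟨hU y hy.1 hv1.1, ?_⟩, hy'⟩
    rw [if_neg hv1.2, hy']
    exact (h.wt_pos hy.1).ne'
  · intro v hv
    rw [Finset.mem_filter] at hv
    have hvx : v ∉ x := fun h' => hv.2 (by rw [if_pos h'])
    rw [if_neg hvx]

lemma sum_wt_singleton (h : X.IsPureCard n) (hn : 1 ≤ n) {U : Finset V}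
    (hU : ∀ x ∈ X.faces, x ⊆ U) : ∑ a ∈ U, X.wt {a} = 1 := by
  have := h.sum_wt_insert hU ∅ (by simpa using hn)
  simpa [h.wt_empty] using this

lemma sum_halfWt (h : X.IsPureCard n) (hn : 2 ≤ n) {U : Finset V}
    (hU : ∀ x ∈ X.faces, x ⊆ U) (a : V) : ∑ b ∈ U, X.halfWt a b = X.wt {a} := by
  have h1 := h.sum_wt_insert hU {a} (by simpa using hn)
  have h2 : ∑ b ∈ U, X.halfWt a b =
      (∑ v ∈ U, (if v ∈ ({a} : Finset V) then 0 else X.wt (insert v {a}))) / 2 := by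
    rw [Finset.sum_div]
    refine Finset.sum_congr rfl fun b _ => ?_
    simp only [halfWt, Finset.mem_singleton, eq_comm (a := b)]
    split_ifs
    · simp
    · rw [Finset.pair_comm]
  rw [h2, h1, Finset.card_singleton]
  push_cast; ring

lemma halfWt_eq_zero {X : FinComplex V} {a b : V} (ha : {a} ∉ X.faces) : X.halfWt a b = 0 := by
  rw [halfWt]
  split_ifs
  · rfl
  · rw [X.wt_eq_zero, zero_div]
    exact fun h' => ha (X.down_closed h' (by simp))

lemma formLE (h : X.IsPureCard n) (hn : 2 ≤ n) {lam : ℝ} (hs : X.SpecLE lam) :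
    X.FormLE lam := by
  intro U hU f
  have h1 := reversible_form_le (ι := X.Vert) (fun a => X.wt {a.1})
    (fun a b => X.halfWt a.1 b.1) lam (fun a => h.wt_pos a.2) (fun a b => X.halfWt_comm _ _)
    (fun a => by
      rw [X.sum_vert hU (fun b => X.halfWt a.1 b) fun b hb => by
        rw [halfWt_comm, halfWt_eq_zero hb], h.sum_halfWt hn hU])
    (by
      rw [X.sum_vert hU (fun b => X.wt {b}) fun b hb => X.wt_eq_zero hb]
      exact h.sum_wt_singleton (by omega) hU)
    (fun μ f hf h0 he => hs μ f hf (by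
      simp only [weight_eq_wt]; exact h0) (by
      funext a; rw [adj_apply, he a]; rfl))
    (fun a => f a.1)
  rw [X.sum_vert hU (fun a => X.wt {a} * f a ^ 2) fun a ha => by rw [X.wt_eq_zero ha, zero_mul],
    X.sum_vert hU (fun a => X.wt {a} * f a) fun a ha => by rw [X.wt_eq_zero ha, zero_mul],
    X.sum_vert hU (fun a => ∑ b : X.Vert, X.halfWt a b * f a * f b.1) fun a ha =>
      Finset.sum_eq_zero fun b _ => by rw [halfWt_eq_zero ha]; ring] at h1
  refine le_trans (le_of_eq ?_) h1
  refine Finset.sum_congr rfl fun a _ => ?_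
  rw [X.sum_vert hU (fun b => X.halfWt a b * f a * f b) fun b hb => by
    rw [halfWt_comm, halfWt_eq_zero hb]; ring]

end IsPureCard

end FinComplex

/-! ### Trickling down. -/

namespace FinComplex

variable {V : Type u} [LinearOrder V]

/-- A sixth of the weight of a triangle, extended by zero to all triples. -/
noncomputable def triWt (X : FinComplex V) (a b c : V) : ℝ :=
  if b = c ∨ a ∈ ({b, c} : Finset V) then 0 else X.wt (insert a {b, c}) / 6

namespace IsPureCard

variable {X : FinComplex V} {n : ℕ}

lemma sum_triWt (h : X.IsPureCard n) (hn : 3 ≤ n) {U : Finset V} (hU : ∀ x ∈ X.faces, x ⊆ U)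
    (b c : V) : ∑ a ∈ U, X.triWt a b c = X.halfWt b c := by
  by_cases hbc : b = c
  · simp [triWt, halfWt, hbc]
  · have h1 := h.sum_wt_insert hU {b, c} (by rw [Finset.card_pair hbc]; omega)
    rw [Finset.card_pair hbc] at h1
    rw [halfWt, if_neg hbc]
    have h2 : ∑ a ∈ U, X.triWt a b c = (∑ v ∈ U, (if v ∈ ({b, c} : Finset V) then 0 else
        X.wt (insert v {b, c}))) / 6 := by
      rw [Finset.sum_div]
      refine Finset.sum_congr rfl fun a _ => ?_
      simp only [triWt, hbc, false_or]
      split_ifs <;> simp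
    rw [h2, h1]
    push_cast; ring

/-- Localization: by this identity and `sum_triWt`, the edge weights of the vertex links average to
those of `X`. -/
lemma wt_mul_halfWt_link (h : X.IsPureCard n) (z : X.Face) {a : V} (hz : z.1 = {a}) (b c : V) :
    X.wt {a} * (X.link z).halfWt b c = X.triWt a b c := by
  by_cases hbc : b = c
  · simp [triWt, halfWt, hbc]
  by_cases ha : a ∈ ({b, c} : Finset V)
  · rw [halfWt, if_neg hbc, triWt, if_pos (Or.inr ha), (X.link z).wt_eq_zero]
    · simp
    · intro hf
      have := disjoint_of_mem_link hf
      rw [hz, Finset.disjoint_singleton_right] at this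
      exact this ha
  · have h1 := h.wt_union z (s := {b, c}) (by rwa [hz, Finset.disjoint_singleton_right])
    rw [hz, Finset.card_pair hbc, Finset.card_singleton, Finset.union_comm,
      ← Finset.insert_eq, Nat.choose_one_right] at h1
    rw [halfWt, if_neg hbc, triWt, if_neg (not_or.mpr ⟨hbc, ha⟩), h1]
    push_cast; ring

lemma wt_mul_wt_link (h : X.IsPureCard n) (z : X.Face) {a : V} (hz : z.1 = {a}) (b : V) :
    X.wt {a} * (X.link z).wt {b} = X.halfWt a b := by
  by_cases hab : a = b
  · rw [halfWt, if_pos hab, (X.link z).wt_eq_zero, mul_zero]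
    intro hf
    have := disjoint_of_mem_link hf
    rw [hz, Finset.disjoint_singleton] at this
    exact this hab.symm
  · have h1 := h.wt_union z (s := {b}) (by
      rw [hz, Finset.disjoint_singleton]; exact fun h' => hab h'.symm)
    rw [hz, Finset.card_singleton, Finset.card_singleton, Finset.union_comm, ← Finset.insert_eq,
      Nat.choose_one_right] at h1
    rw [halfWt, if_neg hab, h1]
    push_cast; ring

/-- Oppenheim's trickling down theorem, one step. -/
theorem specLE_of_link (h : X.IsPureCard n) (hn : 3 ≤ n) (hconn : X.graph.Connected) {lam : ℝ}
    (hlam : lam < 1) (hlink : ∀ z : X.Face, z.1.card = 1 → (X.link z).FormLE lam) :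
    X.SpecLE (lam / (1 - lam)) := by
  classical
  intro μ f hf h0 he
  set U : Finset V := X.faces.biUnion id with hUdef
  have hU : ∀ x ∈ X.faces, x ⊆ U := fun x hx => Finset.subset_biUnion_of_mem id hx
  have hUv : ∀ a ∈ U, {a} ∈ X.faces := by
    intro a ha
    obtain ⟨x, hx, hax⟩ := Finset.mem_biUnion.mp ha
    exact X.down_closed hx (Finset.singleton_subset_iff.mpr hax)
  set F : V → ℝ := fun a => if h' : {a} ∈ X.faces then f ⟨a, h'⟩ else 0 with hF
  have hFf : ∀ a : X.Vert, F a.1 = f a := fun a => by simp [hF, a.2]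
  have hwpos : ∀ a ∈ U, 0 < X.wt {a} := fun a ha => h.wt_pos (hUv a ha)
  have hA : ∀ a ∈ U, ∑ b ∈ U, X.halfWt a b * F b = μ * (X.wt {a} * F a) := by
    intro a ha
    have h1 := congrFun he ⟨a, hUv a ha⟩
    rw [adj_apply] at h1
    simp only [Pi.smul_apply, smul_eq_mul, ← hFf] at h1
    rw [X.sum_vert hU (fun b => X.halfWt a b / X.wt {a} * F b) fun b hb => by
      rw [halfWt_comm, halfWt_eq_zero hb]; simp] at h1
    rw [mul_left_comm, ← h1, Finset.mul_sum]
    refine Finset.sum_congr rfl fun b _ => ?_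
    have := (hwpos a ha).ne'
    field_simp
  have hmean : ∑ a ∈ U, X.wt {a} * F a = 0 := by
    rw [← X.sum_vert hU (fun a => X.wt {a} * F a) fun a ha => by rw [X.wt_eq_zero ha, zero_mul]]
    simp only [weight_eq_wt] at h0
    rw [← h0]
    exact Finset.sum_congr rfl fun a _ => by rw [hFf]; rfl
  set N : ℝ := ∑ a ∈ U, X.wt {a} * F a ^ 2 with hN
  have hNpos : 0 < N := by
    obtain ⟨a, ha⟩ := Function.ne_iff.mp hf
    have haU : a.1 ∈ U := hU _ a.2 (Finset.mem_singleton_self _)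
    refine Finset.sum_pos' (fun b hb => mul_nonneg (hwpos b hb).le (sq_nonneg _))
      ⟨a.1, haU, mul_pos (hwpos _ haU) ?_⟩
    rw [hFf]
    exact sq_pos_of_ne_zero ha
  have hQ : ∑ a ∈ U, ∑ b ∈ U, X.halfWt a b * F a * F b = μ * N := by
    rw [hN, Finset.mul_sum]
    refine Finset.sum_congr rfl fun a ha => ?_
    have : ∑ b ∈ U, X.halfWt a b * F a * F b = F a * ∑ b ∈ U, X.halfWt a b * F b := by
      rw [Finset.mul_sum]
      exact Finset.sum_congr rfl fun b _ => by ring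
    rw [this, hA a ha]; ring
  -- The form bound in the link of `a`, scaled by the weight of `a`. By the eigenvalue equation the
  -- mean of `F` over that link is `μ * F a`.
  have hloc : ∀ a ∈ U, ∑ b ∈ U, ∑ c ∈ U, X.triWt a b c * F b * F c ≤
      lam * ∑ b ∈ U, X.halfWt a b * F b ^ 2 + (1 - lam) * (μ ^ 2 * (X.wt {a} * F a ^ 2)) := by
    intro a ha
    have hUl : ∀ x ∈ (X.link ⟨{a}, hUv a ha⟩).faces, x ⊆ U := fun x hx =>
      hU x (X.down_closed (mem_link.mp hx).2 Finset.subset_union_left)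
    have h1 := mul_le_mul_of_nonneg_left (hlink ⟨{a}, hUv a ha⟩ (by simp) U hUl F)
      (hwpos a ha).le
    have e1 : X.wt {a} * ∑ b ∈ U, ∑ c ∈ U, (X.link ⟨{a}, hUv a ha⟩).halfWt b c * F b * F c =
        ∑ b ∈ U, ∑ c ∈ U, X.triWt a b c * F b * F c := by
      rw [Finset.mul_sum]
      refine Finset.sum_congr rfl fun b _ => ?_
      rw [Finset.mul_sum]
      refine Finset.sum_congr rfl fun c _ => ?_
      rw [← h.wt_mul_halfWt_link ⟨{a}, hUv a ha⟩ rfl]; ring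
    have e2 : X.wt {a} * ∑ b ∈ U, (X.link ⟨{a}, hUv a ha⟩).wt {b} * F b ^ 2 =
        ∑ b ∈ U, X.halfWt a b * F b ^ 2 := by
      rw [Finset.mul_sum]
      refine Finset.sum_congr rfl fun b _ => ?_
      rw [← h.wt_mul_wt_link ⟨{a}, hUv a ha⟩ rfl]; ring
    have e3 : X.wt {a} * ∑ b ∈ U, (X.link ⟨{a}, hUv a ha⟩).wt {b} * F b =
        X.wt {a} * (μ * F a) := by
      rw [mul_left_comm, ← hA a ha, Finset.mul_sum]
      refine Finset.sum_congr rfl fun b _ => ?_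
      rw [← h.wt_mul_wt_link ⟨{a}, hUv a ha⟩ rfl]; ring
    have e4 := mul_left_cancel₀ (hwpos a ha).ne' e3
    rw [e1, e4, mul_add, mul_left_comm, e2] at h1
    refine h1.trans (le_of_eq ?_)
    ring
  -- Summation of the local inequalities over all vertices.
  have hkey : μ * N ≤ lam * N + (1 - lam) * (μ ^ 2 * N) := by
    have h1 := Finset.sum_le_sum hloc
    have e1 : ∑ a ∈ U, ∑ b ∈ U, ∑ c ∈ U, X.triWt a b c * F b * F c = μ * N := by
      rw [← hQ, Finset.sum_comm]
      refine Finset.sum_congr rfl fun b _ => ?_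
      rw [Finset.sum_comm]
      refine Finset.sum_congr rfl fun c _ => ?_
      rw [← Finset.sum_mul, ← Finset.sum_mul, h.sum_triWt hn hU]
    have e2 : ∑ a ∈ U, ∑ b ∈ U, X.halfWt a b * F b ^ 2 = N := by
      rw [Finset.sum_comm]
      refine Finset.sum_congr rfl fun b _ => ?_
      rw [← Finset.sum_mul, Finset.sum_congr rfl fun a _ => X.halfWt_comm a b,
        h.sum_halfWt (by omega) hU]
    rw [e1, Finset.sum_add_distrib, ← Finset.mul_sum, ← Finset.mul_sum, e2, ← Finset.mul_sum]
      at h1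
    exact h1
  have hdir : ∑ a ∈ U, ∑ b ∈ U, X.halfWt a b * (F a - F b) ^ 2 = 2 * (1 - μ) * N := by
    have e1 : ∀ a ∈ U, ∑ b ∈ U, X.halfWt a b * (F a - F b) ^ 2 = X.wt {a} * F a ^ 2 +
        ∑ b ∈ U, X.halfWt a b * F b ^ 2 - 2 * ∑ b ∈ U, X.halfWt a b * F a * F b := by
      intro a _
      rw [← h.sum_halfWt (by omega) hU a, Finset.sum_mul, Finset.mul_sum,
        ← Finset.sum_add_distrib, ← Finset.sum_sub_distrib]
      exact Finset.sum_congr rfl fun b _ => by ring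
    have e2 : ∑ a ∈ U, ∑ b ∈ U, X.halfWt a b * F b ^ 2 = N := by
      rw [Finset.sum_comm]
      refine Finset.sum_congr rfl fun b _ => ?_
      rw [← Finset.sum_mul, Finset.sum_congr rfl fun a _ => X.halfWt_comm a b,
        h.sum_halfWt (by omega) hU]
    rw [Finset.sum_congr rfl e1, Finset.sum_sub_distrib, Finset.sum_add_distrib, e2,
      ← Finset.mul_sum, hQ, ← hN]
    ring
  have hterm : ∀ a ∈ U, ∀ b ∈ U, 0 ≤ X.halfWt a b * (F a - F b) ^ 2 :=
    fun a _ b _ => mul_nonneg (X.halfWt_nonneg a b) (sq_nonneg _)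
  have hμ1 : μ ≤ 1 := by
    have h1 : 0 ≤ 2 * (1 - μ) * N :=
      hdir ▸ Finset.sum_nonneg fun a ha => Finset.sum_nonneg (hterm a ha)
    have := nonneg_of_mul_nonneg_left h1 hNpos
    linarith
  -- For `μ = 1` the Dirichlet form vanishes, so by connectedness `f` is constant, and mean zero
  -- makes it zero.
  have hμ : μ < 1 := by
    refine lt_of_le_of_ne hμ1 fun h1 => ?_
    rw [h1, sub_self, mul_zero, zero_mul,
      Finset.sum_eq_zero_iff_of_nonneg fun a ha => Finset.sum_nonneg (hterm a ha)] at hdir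
    have hadj : ∀ a b : X.Vert, X.graph.Adj a b → f a = f b := by
      intro a b hab
      have haU : a.1 ∈ U := hU _ a.2 (Finset.mem_singleton_self _)
      have hbU : b.1 ∈ U := hU _ b.2 (Finset.mem_singleton_self _)
      have h2 := (Finset.sum_eq_zero_iff_of_nonneg (hterm a.1 haU)).mp (hdir a.1 haU) b.1 hbU
      have h3 : X.halfWt a.1 b.1 ≠ 0 := by
        rw [halfWt, if_neg fun h' => hab.1 (Subtype.ext h')]
        exact (half_pos (h.wt_pos hab.2)).ne'
      have h4 := pow_eq_zero_iff (two_ne_zero) |>.mp ((mul_eq_zero.mp h2).resolve_left h3)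
      rw [← hFf, ← hFf]
      linarith
    have hreach : ∀ a b : X.Vert, f a = f b := by
      intro a b
      obtain ⟨p⟩ := hconn.preconnected a b
      induction p with
      | nil => rfl
      | cons hab _ ih => exact (hadj _ _ hab).trans ih
    obtain ⟨a⟩ := hconn.nonempty
    have h5 : ∀ b ∈ U, F b = f a := by
      intro b hb
      rw [← hreach ⟨b, hUv b hb⟩ a, ← hFf]
    rw [Finset.sum_congr rfl fun b hb => by rw [h5 b hb], ← Finset.sum_mul,
      h.sum_wt_singleton (by omega) hU, one_mul] at hmean
    exact hf (funext fun b => (hreach b a).trans hmean)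
  have h1 : μ ≤ lam + (1 - lam) * μ ^ 2 := by
    refine le_of_mul_le_mul_right ?_ hNpos
    linarith
  rw [le_div_iff₀ (by linarith)]
  by_contra h2
  -- The inequality `h1` factors as `0 ≤ (1 - μ) * (lam - (1 - lam) * μ)`, and the first factor is
  -- positive.
  nlinarith [mul_pos (sub_pos.mpr hμ) (sub_pos.mpr (not_le.mp h2))]

end IsPureCard

/-- Trickling down from the links of dimension `1` to all links of dimension at least `1`. -/
theorem IsPureCard.formLE_link {X : FinComplex V} {d : ℕ} (h : X.IsPureCard (d + 1))
    (hd : 1 ≤ d) (hconn : X.StronglyConnected) {lam m : ℝ} (hlam : 0 < lam) (hm : m ≤ 1)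
    (hlm : lam ≤ m / d) (hloc : X.IsLocalSpectralExpander ((d : ℤ) - 2) lam) (z : X.Face)
    (hz : z.1.card + 1 ≤ d) : (X.link z).FormLE m := by
  have hd0 : (0 : ℝ) < d := by exact_mod_cast hd
  have hld : lam * d ≤ m := by rwa [le_div_iff₀ hd0] at hlm
  -- Here the link of `z` has dimension `t + 1`, so `t = 0` is the spectral hypothesis.
  have key : ∀ (t : ℕ) (z : X.Face), z.1.card + t + 1 = d →
      (X.link z).SpecLE (lam / (1 - t * lam)) := by
    intro t
    induction t with
    | zero =>
      intro z hz
      rw [Nat.cast_zero, zero_mul, sub_zero, div_one]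
      exact (hloc z (mem_cells_int.mpr (by omega))).specLE
    | succ t ih =>
      intro z hz
      have hpz := h.link z
      have htd : ((t : ℝ) + 2) ≤ d := by exact_mod_cast (by omega : t + 2 ≤ d)
      have hpos : 0 < 1 - (t + 1) * lam := by nlinarith
      have hpos' : 0 < 1 - t * lam := by nlinarith
      have hlt : lam / (1 - t * lam) < 1 := by rw [div_lt_one hpos']; linarith
      have := hpz.specLE_of_link (by omega) (hconn z (by
        rw [dim, hpz.sup_card]; omega)) hlt fun v hv => by
          have hp := (h.link (unlink v)).formLE (by rw [card_unlink]; omega)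
            (ih (unlink v) (by rw [card_unlink]; omega))
          rw [link_link]; exact hp
      -- The map `x ↦ x / (1 - x)` sends `lam / (1 - t * lam)` to `lam / (1 - (t + 1) * lam)`.
      refine this.mono (le_of_eq ?_)
      push_cast
      rw [one_sub_div hpos'.ne', div_div_div_cancel_right₀ hpos'.ne']
      ring_nf
  obtain ⟨t, ht⟩ := Nat.exists_eq_add_of_le hz
  refine (h.link z).formLE (by omega) ((key t z (by omega)).mono ?_)
  have htd : ((t : ℝ) + 1) ≤ d := by exact_mod_cast (by omega : t + 1 ≤ d)
  have hpos' : 0 < 1 - t * lam := by nlinarith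
  -- Since `m ≤ 1`, one has `lam * (1 + t * m) ≤ lam * (1 + t) ≤ lam * d ≤ m`.
  rw [div_le_iff₀ hpos']
  have h0 : (0 : ℝ) ≤ t := Nat.cast_nonneg t
  nlinarith [mul_nonneg h0 hlam.le, mul_le_mul_of_nonneg_right hm (mul_nonneg h0 hlam.le)]

end FinComplex

/-! ### Cochains, their norm, and their restriction to links. -/

lemma neg_one_pow_smul_eq_zero {A : Type*} [AddCommGroup A] (n : ℕ) (s : A) :
    ((-1 : ℤ) ^ n) • s = 0 ↔ s = 0 := by
  rcases neg_one_pow_eq_or ℤ n with h | h <;> simp [h]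

lemma card_filter_lt_erase {V : Type u} [LinearOrder V] {y : Finset V} {a : V} (ha : a ∈ y)
    (b : V) : (y.filter fun c => c < b).card =
      ((y.erase a).filter fun c => c < b).card + if a < b then 1 else 0 := by
  nth_rewrite 1 [← Finset.insert_erase ha]
  rw [Finset.filter_insert]
  split_ifs with h
  · exact Finset.card_insert_of_notMem (by simp)
  · rfl

namespace AugSheaf

variable {V : Type u} [LinearOrder V] {X : FinComplex V} (F : AugSheaf.{u, v} X)

lemma d_apply (f : F.Cochain) (y : X.Face) : F.d f y = ∑ a : {a : V // a ∈ y.1},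
    ((-1 : ℤ) ^ (y.1.filter fun b => b < a.1).card) •
      F.res (removeVertex_ssubset a.2) (f (removeVertex y a.1)) := rfl

lemma res_congr (f : F.Cochain) {x x' y : X.Face} (h : x = x') (hx : x.1 ⊂ y.1)
    (hx' : x'.1 ⊂ y.1) : F.res hx (f x) = F.res hx' (f x') := by
  subst h; rfl

lemma removeVertex_dim {y : X.Face} {a : V} (h : a ∈ y.1) :
    (removeVertex y a).dim = y.dim - 1 := by
  have h1 : (removeVertex y a).1.card = y.1.card - 1 := Finset.card_erase_of_mem h
  have h2 : 0 < y.1.card := Finset.card_pos.mpr ⟨a, h⟩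
  simp only [Face.dim]
  omega

lemma d_mem {F : AugSheaf.{u, v} X} {k : ℤ} {f : F.Cochain} (hf : f ∈ F.C k) :
    F.d f ∈ F.C (k + 1) := by
  intro y hy
  rw [d_apply]
  refine Finset.sum_eq_zero fun a _ => ?_
  rw [hf _ (by rw [removeVertex_dim a.2]; omega), map_zero, smul_zero]

lemma d_d (f : F.Cochain) : F.d (F.d f) = 0 := by
  funext y
  rw [d_apply, Pi.zero_apply]
  have h1 : ∀ a : {a : V // a ∈ y.1}, ((-1 : ℤ) ^ (y.1.filter fun b => b < a.1).card) •
      F.res (removeVertex_ssubset a.2) (F.d f (removeVertex y a.1)) =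
      ∑ b : {b : V // b ∈ (removeVertex y a.1).1},
        ((-1 : ℤ) ^ (y.1.filter fun c => c < a.1).card *
          (-1 : ℤ) ^ ((y.1.erase a.1).filter fun c => c < b.1).card) •
        F.res ((removeVertex_ssubset b.2).trans (removeVertex_ssubset a.2))
          (f (removeVertex (removeVertex y a.1) b.1)) := by
    intro a
    rw [d_apply, map_sum, Finset.smul_sum]
    refine Finset.sum_congr rfl fun b _ => ?_
    rw [map_zsmul, F.res_res, smul_smul]
    rfl
  rw [Finset.sum_congr rfl fun a _ => h1 a, Finset.sum_sigma']
  -- The involution swaps the order in which two vertices are removed. Only the position of the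
  -- larger one depends on this order, and it shifts by one, so the signs are opposite.
  refine Finset.sum_involution
    (fun p _ => ⟨⟨p.2.1, Finset.mem_of_mem_erase p.2.2⟩,
      ⟨p.1.1, Finset.mem_erase.mpr ⟨(Finset.ne_of_mem_erase p.2.2).symm, p.1.2⟩⟩⟩)
    ?_ ?_ (fun _ _ => Finset.mem_sigma.mpr ⟨Finset.mem_univ _, Finset.mem_univ _⟩)
    (fun _ _ => rfl)
  · rintro ⟨⟨a, ha⟩, ⟨b, hb⟩⟩ _
    have hba : b ≠ a := Finset.ne_of_mem_erase hb
    have hby : b ∈ y.1 := Finset.mem_of_mem_erase hb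
    have hE : removeVertex (removeVertex y b) a = removeVertex (removeVertex y a) b :=
      Subtype.ext (Finset.erase_right_comm)
    simp only
    rw [F.res_congr f hE _ ((removeVertex_ssubset hb).trans (removeVertex_ssubset ha)),
      ← add_smul]
    convert zero_smul ℤ _
    rw [card_filter_lt_erase ha b, card_filter_lt_erase hby a]
    rcases lt_or_gt_of_ne hba with h | h
    · rw [if_neg h.not_gt, if_pos h]; ring
    · rw [if_pos h, if_neg h.not_gt]; ring
  · rintro ⟨⟨a, ha⟩, ⟨b, hb⟩⟩ _ _ h
    have hba : b ≠ a := Finset.ne_of_mem_erase hb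
    exact hba (congrArg (fun p => p.1.1) h)

/-! ### The weighted support norm -/

lemma weight_nonneg (x : X.Face) : 0 ≤ X.weight x := by
  rw [weight_eq_wt]; exact X.wt_nonneg _

lemma secNorm_nonneg (x : X.Face) (s : F.sec x) : 0 ≤ F.secNorm x s := by
  unfold secNorm
  split_ifs
  exacts [le_rfl, weight_nonneg x]

lemma secNorm_le (x : X.Face) (s : F.sec x) : F.secNorm x s ≤ X.weight x := by
  unfold secNorm
  split_ifs
  exacts [weight_nonneg x, le_rfl]

lemma secNorm_zero (x : X.Face) : F.secNorm x 0 = 0 := if_pos rfl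

lemma secNorm_of_ne {x : X.Face} {s : F.sec x} (h : s ≠ 0) : F.secNorm x s = X.weight x :=
  if_neg h

lemma secNorm_add_le (x : X.Face) (s t : F.sec x) :
    F.secNorm x (s + t) ≤ F.secNorm x s + F.secNorm x t := by
  by_cases hs : s = 0
  · rw [hs, zero_add, secNorm_zero, zero_add]
  · rw [F.secNorm_of_ne hs]
    exact (F.secNorm_le _ _).trans (le_add_of_nonneg_right (F.secNorm_nonneg _ _))

lemma norm_nonneg (f : F.Cochain) : 0 ≤ F.norm f :=
  Finset.sum_nonneg fun x _ => F.secNorm_nonneg x _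

lemma norm_zero : F.norm 0 = 0 :=
  Finset.sum_eq_zero fun x _ => F.secNorm_zero x

lemma norm_add_le (f g : F.Cochain) : F.norm (f + g) ≤ F.norm f + F.norm g := by
  unfold norm
  rw [← Finset.sum_add_distrib]
  exact Finset.sum_le_sum fun x _ => F.secNorm_add_le x _ _

lemma norm_neg (f : F.Cochain) : F.norm (-f) = F.norm f := by
  refine Finset.sum_congr rfl fun x _ => ?_
  change F.secNorm x (-(f x)) = _
  by_cases h : f x = 0
  · rw [h, neg_zero]
  · rw [F.secNorm_of_ne h, F.secNorm_of_ne (neg_ne_zero.mpr h)]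

lemma eq_zero_of_norm {n : ℕ} (h : X.IsPureCard n) {f : F.Cochain} (hf : F.norm f ≤ 0) :
    f = 0 := by
  have h0 := le_antisymm hf (F.norm_nonneg f)
  unfold norm at h0
  rw [Finset.sum_eq_zero_iff_of_nonneg fun x _ => F.secNorm_nonneg x _] at h0
  funext x
  by_contra hx
  have := h0 x (Finset.mem_univ x)
  rw [F.secNorm_of_ne hx, weight_eq_wt] at this
  exact (h.wt_pos x.2).ne' this

/-- The sum of a function on the faces with `j` vertices, as a sum over sets of vertices. -/
lemma sum_face_filter (p : Finset V → Prop) [DecidablePred p] :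
    ∑ x : X.Face with p x.1, X.weight x = ∑ y ∈ X.faces with p y, X.wt y := by
  refine Finset.sum_bij (fun x _ => x.1) ?_ (fun a _ b _ h => Subtype.ext h) ?_ ?_
  · intro x hx
    exact Finset.mem_filter.mpr ⟨x.2, (Finset.mem_filter.mp hx).2⟩
  · intro y hy
    rw [Finset.mem_filter] at hy
    exact ⟨⟨y, hy.1⟩, Finset.mem_filter.mpr ⟨Finset.mem_univ _, hy.2⟩, rfl⟩
  · intro x _
    exact X.weight_eq_wt x

open Classical in
lemma norm_eq_sum (f : F.Cochain) : F.norm f = ∑ x : X.Face with f x ≠ 0, X.weight x := by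
  rw [Finset.sum_filter]
  refine Finset.sum_congr rfl fun x _ => ?_
  by_cases h : f x = 0
  · simp [h, secNorm_zero]
  · rw [F.secNorm_of_ne h, if_pos h]

/-- With nontrivial groups every supremum is the weight of its face. The mass factors thus disappear
from all expansion inequalities. -/
lemma mass_eq_one {n : ℕ} (h : X.IsPureCard n) {k : ℤ} (hk : -1 ≤ k) (hkn : k + 1 ≤ n)
    (hF : ∀ x ∈ X.cells k, Nontrivial (F.sec x)) : F.mass k = 1 := by
  obtain ⟨j, rfl⟩ : ∃ j : ℕ, k = (j : ℤ) - 1 := ⟨(k + 1).toNat, by omega⟩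
  have h1 : F.mass (j - 1) = ∑ x ∈ X.cells (j - 1), X.weight x := by
    refine Finset.sum_congr rfl fun x hx => ?_
    have := hF x hx
    obtain ⟨s, hs⟩ := exists_ne (0 : F.sec x)
    refine le_antisymm (ciSup_le fun t => F.secNorm_le x t) ?_
    rw [← F.secNorm_of_ne hs]
    exact le_ciSup (f := fun t => F.secNorm x t)
      ⟨X.weight x, Set.forall_mem_range.mpr fun t => F.secNorm_le x t⟩ s
  rw [h1, ← h.sum_wt_card (j := j) (by omega), ← sum_face_filter fun y => y.card = j]
  refine Finset.sum_congr ?_ fun _ _ => rfl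
  ext x
  rw [mem_cells_int, Finset.mem_filter]
  simp only [Finset.mem_univ, true_and]
  omega

lemma norm_le_one {n : ℕ} (h : X.IsPureCard n) {j : ℕ} (hj : j + 1 ≤ n) {f : F.Cochain}
    (hf : f ∈ F.C j) : F.norm f ≤ 1 := by
  classical
  rw [norm_eq_sum, ← h.sum_wt_card hj, ← sum_face_filter fun y => y.card = j + 1]
  refine Finset.sum_le_sum_of_subset_of_nonneg ?_ fun x _ _ => weight_nonneg x
  intro x hx
  rw [Finset.mem_filter] at hx ⊢
  refine ⟨Finset.mem_univ _, ?_⟩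
  by_contra hc
  exact hx.2 (hf x (by simp only [Face.dim]; omega))

lemma quotNorm_le {H : AddSubgroup F.Cochain} {f g : F.Cochain} (hg : g ∈ H) :
    F.quotNorm H f ≤ F.norm (f + g) :=
  ciInf_le (f := fun b : H => F.norm (f + b.1))
    ⟨0, Set.forall_mem_range.mpr fun _ => F.norm_nonneg _⟩ ⟨g, hg⟩

lemma quotNorm_le_norm (H : AddSubgroup F.Cochain) (f : F.Cochain) :
    F.quotNorm H f ≤ F.norm f := by
  simpa using F.quotNorm_le (f := f) H.zero_mem

lemma le_quotNorm {H : AddSubgroup F.Cochain} {f : F.Cochain} {r : ℝ}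
    (h : ∀ g ∈ H, r ≤ F.norm (f + g)) : r ≤ F.quotNorm H f :=
  le_ciInf fun b => h b.1 b.2

/-! ### Restriction to links -/

/-- The sign comparing the order of `x` followed by `z` with the increasing order of `x ∪ z`. -/
def shuffleSign (x z : Finset V) : ℤ := (-1) ^ ((x ×ˢ z).filter fun p => p.2 < p.1).card

lemma shuffleSign_smul_eq_zero {A : Type*} [AddCommGroup A] (x z : Finset V) (s : A) :
    shuffleSign x z • s = 0 ↔ s = 0 := neg_one_pow_smul_eq_zero _ s

lemma shuffleSign_mul_self (x z : Finset V) : shuffleSign x z * shuffleSign x z = 1 := by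
  rw [shuffleSign, ← mul_pow]; simp

lemma shuffleSign_erase {x : Finset V} (z : Finset V) {a : V} (ha : a ∈ x) :
    shuffleSign x z = shuffleSign (x.erase a) z * (-1) ^ (z.filter fun q => q < a).card := by
  have h : ∀ t : Finset V, ((t ×ˢ z).filter fun p => p.2 < p.1).card =
      ∑ b ∈ t, (z.filter fun q => q < b).card := by
    intro t
    simp only [Finset.card_filter, Finset.sum_product]
  rw [shuffleSign, shuffleSign, ← pow_add, h, h, Finset.sum_erase_add _ _ ha]

/-- The restriction of a cochain to a link. -/
def restr (z : X.Face) (h : F.Cochain) : (F.link z).Cochain :=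
  fun x => (shuffleSign x.1 z.1 • h (unlink x) : F.sec (unlink x))

lemma restr_add (z : X.Face) (h h' : F.Cochain) :
    F.restr z (h + h') = F.restr z h + F.restr z h' := by
  funext x
  exact smul_add (shuffleSign x.1 z.1) (h (unlink x)) (h' (unlink x))

lemma restr_mem {F : AugSheaf.{u, v} X} {k : ℤ} {z : X.Face} {h : F.Cochain} (hh : h ∈ F.C k) :
    F.restr z h ∈ (F.link z).C (k - z.dim - 1) := by
  intro x hx
  have : h (unlink x) = 0 := hh _ (by
    have := card_unlink x
    simp only [Face.dim] at hx ⊢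
    omega)
  change shuffleSign x.1 z.1 • h (unlink x) = 0
  rw [this, smul_zero]

/-- Removing a vertex of `z` leads to a face where `h` vanishes, so only vertices of the link
contribute. For these the position in `x ∪ z` exceeds that in `x` by the number of smaller vertices
of `z`, which is exactly the change of the shuffle sign. -/
lemma d_restr (z : X.Face) {h : F.Cochain} (hh : ∀ y : X.Face, ¬ z.1 ⊆ y.1 → h y = 0) :
    (F.link z).d (F.restr z h) = F.restr z (F.d h) := by
  funext x
  change ∑ a : {a : V // a ∈ x.1}, ((-1 : ℤ) ^ (x.1.filter fun b => b < a.1).card) •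
      F.res (unlink_ssubset (removeVertex_ssubset a.2))
        (shuffleSign (x.1.erase a.1) z.1 • h (unlink (removeVertex x a.1))) =
    shuffleSign x.1 z.1 • ∑ a : {a : V // a ∈ x.1 ∪ z.1},
      ((-1 : ℤ) ^ ((x.1 ∪ z.1).filter fun b => b < a.1).card) •
      F.res (removeVertex_ssubset (y := unlink x) a.2) (h (removeVertex (unlink x) a.1))
  rw [Finset.smul_sum]
  have hd := disjoint_of_mem_link x.2
  refine Fintype.sum_of_injective
    (fun a : {a : V // a ∈ x.1} =>
      (⟨a.1, Finset.mem_union_left _ a.2⟩ : {a : V // a ∈ x.1 ∪ z.1}))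
    (fun a b hab => Subtype.ext (congrArg (fun t => t.1) hab)) _ _ ?_ ?_
  · rintro ⟨a, ha⟩ hna
    have haz : a ∈ z.1 := by
      rcases Finset.mem_union.mp ha with h1 | h1
      · exact absurd ⟨⟨a, h1⟩, rfl⟩ hna
      · exact h1
    have : h (removeVertex (unlink x) a) = 0 :=
      hh _ fun hsub => (Finset.notMem_erase a _) (hsub haz)
    simp only
    rw [this, map_zero, smul_zero, smul_zero]
  · rintro ⟨a, ha⟩
    have haz : a ∉ z.1 := Finset.disjoint_left.mp hd ha
    have hE : unlink (removeVertex x a) = removeVertex (unlink x) a := by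
      apply Subtype.ext
      change x.1.erase a ∪ z.1 = (x.1 ∪ z.1).erase a
      rw [Finset.erase_union_distrib, Finset.erase_eq_of_notMem haz]
    simp only
    rw [map_zsmul, F.res_congr h hE _ (removeVertex_ssubset (Finset.mem_union_left _ ha)),
      smul_smul, smul_smul]
    congr 1
    rw [shuffleSign_erase z.1 ha, Finset.filter_union, Finset.card_union_of_disjoint
      (Finset.disjoint_filter_filter hd), pow_add]
    have h1 : ((-1 : ℤ) ^ (z.1.filter fun q => q < a).card) *
        ((-1 : ℤ) ^ (z.1.filter fun q => q < a).card) = 1 := by rw [← mul_pow]; simp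
    linear_combination (-1 : ℤ) ^ (x.1.filter fun b => b < a).card *
      shuffleSign (x.1.erase a) z.1 * (-h1)

lemma d_eq_zero_of_not_subset {z : X.Face} {h : F.Cochain}
    (hh : ∀ y : X.Face, ¬ z.1 ⊆ y.1 → h y = 0) (y : X.Face) (hy : ¬ z.1 ⊆ y.1) :
    F.d h y = 0 := by
  rw [d_apply]
  refine Finset.sum_eq_zero fun a _ => ?_
  rw [hh _ fun h' => hy (h'.trans (Finset.erase_subset _ _)), map_zero, smul_zero]

lemma IsExtension.restr_eq {F : AugSheaf.{u, v} X} {z : X.Face} {g : (F.link z).Cochain}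
    {G : F.Cochain} (h : F.IsExtension z g G) : F.restr z G = g := by
  funext x
  change shuffleSign x.1 z.1 • G (unlink x) = F.linkValue g x
  rw [h.1 x, ← shuffleSign, smul_smul, shuffleSign_mul_self, one_smul]

lemma exists_extension (z : X.Face) (g : (F.link z).Cochain) : ∃ G, F.IsExtension z g G := by
  classical
  refine ⟨∑ x : (X.link z).Face, Pi.single (unlink x)
    (shuffleSign x.1 z.1 • F.linkValue g x), fun x => ?_, fun y hy => ?_⟩
  · rw [Finset.sum_apply, Finset.sum_eq_single x, Pi.single_eq_same]
    · rfl
    · intro x' _ hx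
      exact Pi.single_eq_of_ne (fun h => hx (unlink_injective h.symm)) _
    · exact fun h => absurd (Finset.mem_univ x) h
  · rw [Finset.sum_apply]
    refine Finset.sum_eq_zero fun x _ => Pi.single_eq_of_ne (fun h => hy ?_) _
    rw [h]
    exact Finset.subset_union_right

lemma IsExtension.mem_C {F : AugSheaf.{u, v} X} {z : X.Face} {g : (F.link z).Cochain}
    {G : F.Cochain} (h : F.IsExtension z g G) {k : ℤ} (hg : g ∈ (F.link z).C (k - z.dim - 1)) :
    G ∈ F.C k := by
  intro y hy
  by_cases hzy : z.1 ⊆ y.1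
  · obtain ⟨x, rfl⟩ := exists_unlink hzy
    have : F.linkValue g x = 0 := hg x (by
      have := card_unlink x
      simp only [Face.dim] at hy ⊢
      omega)
    rw [h.1 x, this, smul_zero]
  · exact h.2 y hzy

/-- Restriction scales the norm by a constant depending only on `z` and the number `j` of vertices,
so inequalities of norms pass between `X` and the link. -/
lemma norm_restr {n : ℕ} (hX : X.IsPureCard n) (z : X.Face) {h : F.Cochain}
    (hh : ∀ y : X.Face, ¬ z.1 ⊆ y.1 → h y = 0) {j : ℕ} (hj : h ∈ F.C ((j : ℤ) - 1)) :
    F.norm h = (j.choose z.1.card : ℕ) * X.weight z * (F.link z).norm (F.restr z h) := by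
  unfold norm
  rw [Finset.mul_sum]
  symm
  refine Fintype.sum_of_injective unlink unlink_injective _ _ ?_ ?_
  · intro y hy
    rw [hh y fun hzy => hy (exists_unlink hzy), secNorm_zero]
  · intro x
    by_cases hx : h (unlink x) = 0
    · have : F.restr z h x = 0 := by
        change shuffleSign x.1 z.1 • h (unlink x) = 0
        rw [hx, smul_zero]
      rw [hx, this, secNorm_zero, secNorm_zero, mul_zero]
    · have h0 : F.restr z h x ≠ 0 := by
        change shuffleSign x.1 z.1 • h (unlink x) ≠ 0
        exact fun h' => hx ((shuffleSign_smul_eq_zero _ _ _).mp h')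
      rw [secNorm_of_ne _ hx, secNorm_of_ne _ h0, hX.weight_unlink]
      have hc : x.1.card + z.1.card = j := by
        by_contra hc
        refine hx (hj _ ?_)
        have := card_unlink x
        simp only [Face.dim]
        omega
      rw [hc]

end AugSheaf

/-! ### Expansion of the part of a locally minimal cochain lying over a face. -/

namespace AugSheaf

variable {V : Type u} [LinearOrder V] {X : FinComplex V} (F : AugSheaf.{u, v} X)

/-- A part `f'` of a locally minimal cochain that is supported on the faces containing `z` is
minimal in the link of `z`, and is therefore expanded as well as the link allows. -/
lemma IsLocallyMinimalAt.le_norm_d {F : AugSheaf.{u, v} X} {n k j : ℕ} (hX : X.IsPureCard n)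
    (hkn : k + 2 ≤ n) {z : X.Face} (hz : z.1.card = j + 1) (hjk : j ≤ k) {ε : ℝ}
    (hexp : (F.link z).IsCoboundaryExpander ((k : ℤ) - j - 1) ε)
    (hF : ∀ x : X.Face, x.1.card = k + 1 ∨ x.1.card = k + 2 → Nontrivial (F.sec x))
    {f f' : F.Cochain} (hf : f ∈ F.C k) (hmin : F.IsLocallyMinimalAt k f z)
    (hsub : ∀ x, f' x = f x ∨ f' x = 0) (hsupp : ∀ y : X.Face, ¬ z.1 ⊆ y.1 → f' y = 0) :
    ((k : ℝ) + 2) * ε / ((k : ℝ) + 1 - j) * F.norm f' ≤ F.norm (F.d f') := by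
  have hzdim : z.dim = j := by simp only [Face.dim]; omega
  have hf' : f' ∈ F.C k := fun x hx => by
    rcases hsub x with h | h
    · rw [h]; exact hf x hx
    · exact h
  have hf'1 : f' ∈ F.C (((k + 1 : ℕ) : ℤ) - 1) := by convert hf' using 2; push_cast; ring
  have hdf' : F.d f' ∈ F.C (((k + 2 : ℕ) : ℤ) - 1) := by
    convert d_mem hf' using 2; push_cast; ring
  have hpl := hX.link z
  have hwz : 0 < X.weight z := by rw [weight_eq_wt]; exact hX.wt_pos z.2
  have hn1 := F.norm_restr hX z hsupp hf'1
  have hn2 := F.norm_restr hX z (F.d_eq_zero_of_not_subset hsupp) hdf'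
  have hch1 : 0 < (k + 1).choose (j + 1) := Nat.choose_pos (by omega)
  rw [hz] at hn1 hn2
  set φ := F.restr z f' with hφ
  have hφC : φ ∈ (F.link z).C ((k : ℤ) - j - 1) := by
    have := restr_mem (z := z) hf'
    rwa [hzdim] at this
  -- The supports of `f'` and `f - f'` are disjoint.
  have hsplit : F.norm f = F.norm f' + F.norm (f - f') := by
    unfold norm
    rw [← Finset.sum_add_distrib]
    refine Finset.sum_congr rfl fun x _ => ?_
    change _ = _ + F.secNorm x (f x - f' x)
    rcases hsub x with h | h
    · rw [h, sub_self, secNorm_zero, add_zero]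
    · rw [h, sub_zero, secNorm_zero, zero_add]
  -- A coboundary in the link that shortened `φ` would extend to one on `X` that shortens `f'`, and
  -- then also `f`, against local minimality.
  have hquot : (F.link z).norm φ ≤ (F.link z).quotNorm ((F.link z).B ((k : ℤ) - j - 1)) φ := by
    refine le_quotNorm _ ?_
    rintro _ ⟨g, hg, rfl⟩
    obtain ⟨G, hG⟩ := F.exists_extension z g
    have hgC : g ∈ (F.link z).C ((k : ℤ) - z.dim - 2) := by
      rw [hzdim]; convert SetLike.mem_coe.mp hg using 2; ring
    have hm := hmin g hgC G hG
    have hGC : G ∈ F.C ((k : ℤ) - 1) := hG.mem_C (by convert hgC using 2; ring)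
    have hdG : F.d G ∈ F.C (((k + 1 : ℕ) : ℤ) - 1) := by
      convert d_mem hGC using 2; push_cast; ring
    have hsum : ∀ y : X.Face, ¬ z.1 ⊆ y.1 → (f' + F.d G) y = 0 := by
      intro y hy
      change f' y + F.d G y = 0
      rw [hsupp y hy, F.d_eq_zero_of_not_subset hG.2 y hy, add_zero]
    have hn3 := F.norm_restr hX z hsum (AddSubgroup.add_mem _ hf'1 hdG)
    rw [restr_add, ← F.d_restr z hG.2, hG.restr_eq, hz, ← hφ] at hn3
    have h1 : F.norm (f + F.d G) ≤ F.norm (f' + F.d G) + F.norm (f - f') := by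
      have := F.norm_add_le (f' + F.d G) (f - f')
      rwa [show f' + F.d G + (f - f') = f + F.d G by abel] at this
    have h2 : F.norm f' ≤ F.norm (f' + F.d G) := by linarith
    rw [hn1, hn3] at h2
    exact le_of_mul_le_mul_left h2 (mul_pos (by exact_mod_cast hch1) hwz)
  have hm1 : (F.link z).mass ((k : ℤ) - j - 1) = 1 := by
    refine mass_eq_one _ hpl (by omega) (by omega) fun x hx => ?_
    rw [mem_cells_int] at hx
    exact hF (unlink x) (Or.inl (by rw [card_unlink]; omega))
  have hm2 : (F.link z).mass ((k : ℤ) - j - 1 + 1) = 1 := by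
    refine mass_eq_one _ hpl (by omega) (by omega) fun x hx => ?_
    rw [mem_cells_int] at hx
    exact hF (unlink x) (Or.inr (by rw [card_unlink]; omega))
  have hmain := hexp φ hφC
  rw [hm1, hm2, mul_one, mul_one,
    le_antisymm (quotNorm_le_norm _ _ _) hquot, F.d_restr z hsupp] at hmain
  have hkj : (0 : ℝ) < (k : ℝ) + 1 - j := by
    have : (j : ℝ) ≤ k := by exact_mod_cast hjk
    linarith
  -- The scaling constants of `norm_restr` for `f'` and `d f'` have ratio `(k + 1 - j) / (k + 2)`;
  -- this is the origin of the factor in the definition of `ε`.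
  have hchoose : (((k + 1).choose (j + 1) : ℕ) : ℝ) * ((k : ℝ) + 2) =
      ((k + 2).choose (j + 1) : ℕ) * ((k : ℝ) + 1 - j) := by
    have h1 := Nat.choose_mul_succ_eq (k + 1) (j + 1)
    rw [show k + 1 + 1 - (j + 1) = k + 1 - j by omega] at h1
    have h2 : ((k + 1 - j : ℕ) : ℝ) = (k : ℝ) + 1 - j := by
      rw [Nat.cast_sub (by omega)]; push_cast; ring
    rw [← h2]
    exact_mod_cast h1
  rw [hn1, hn2, div_mul_eq_mul_div, div_le_iff₀ hkj]
  calc ((k : ℝ) + 2) * ε * ((((k + 1).choose (j + 1) : ℕ) : ℝ) * X.weight z * (F.link z).norm φ)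
      = (((k + 1).choose (j + 1) : ℕ) : ℝ) * ((k : ℝ) + 2) * X.weight z *
          (ε * (F.link z).norm φ) := by ring
    _ ≤ (((k + 1).choose (j + 1) : ℕ) : ℝ) * ((k : ℝ) + 2) * X.weight z *
          (F.link z).norm (F.restr z (F.d f')) := by gcongr
    _ = _ := by rw [hchoose]; ring

/-- The cochains of the link in question have degree at most `-2`, hence vanish. This handles
terminal faces of dimension `k`, which lie outside the range of `IsLocallyMinimal`. -/
lemma isLocallyMinimalAt_of_dim (F : AugSheaf.{u, v} X) {k : ℤ} (f : F.Cochain) {z : X.Face}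
    (hz : k ≤ z.dim) : F.IsLocallyMinimalAt k f z := by
  intro g hg G hG
  have h0 : g = 0 := by
    funext x
    exact hg x (by simp only [Face.dim] at hz ⊢; omega)
  have h1 : G = 0 := by
    funext y
    by_cases hzy : z.1 ⊆ y.1
    · obtain ⟨x, rfl⟩ := exists_unlink hzy
      have h2 : F.linkValue g x = 0 := by rw [h0]; rfl
      rw [hG.1 x, h2, smul_zero]
      rfl
    · exact hG.2 y hzy
  rw [h1, map_zero, add_zero]

end AugSheaf

/-! ### Fat faces and clashes. -/

namespace FinComplex

variable {V : Type u} [LinearOrder V]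

/-- The vertices of `X`, as elements of `V`. -/
def vertices (X : FinComplex V) : Finset V := X.faces.biUnion id

lemma subset_vertices (X : FinComplex V) : ∀ x ∈ X.faces, x ⊆ X.vertices :=
  fun _ hx => Finset.subset_biUnion_of_mem id hx

/-- The faces reached from the set `S` of `K`-element faces by passing `r` times from a set of faces
to the set of those faces of one dimension less that are contained in many of them. -/
noncomputable def fat (X : FinComplex V) (K : ℕ) (c : ℝ) (S : Finset (Finset V)) :
    ℕ → Finset (Finset V)
  | 0 => S
  | r + 1 => X.faces.filter fun x => x.card + (r + 1) = K ∧
      c ^ (2 ^ r) * (x.card + 1) * X.wt x ≤ ∑ y ∈ X.fat K c S r with x ⊆ y, X.wt y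

/-- Each `x` has only `q + 1` subsets with `q` elements. -/
lemma sum_sum_superset_le (X : FinComplex V) (q : ℕ) (A B : Finset (Finset V))
    (hA : ∀ x ∈ A, x.card = q + 1) (hB : ∀ z ∈ B, z.card = q) :
    ∑ z ∈ B, ∑ x ∈ A with z ⊆ x, X.wt x ≤ (q + 1) * ∑ x ∈ A, X.wt x := by
  simp only [Finset.sum_filter]
  rw [Finset.sum_comm, Finset.mul_sum]
  refine Finset.sum_le_sum fun x hx => ?_
  rw [← Finset.sum_filter, Finset.sum_const, nsmul_eq_mul]
  refine mul_le_mul_of_nonneg_right ?_ (X.wt_nonneg x)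
  have h1 : (B.filter fun z => z ⊆ x) ⊆ x.powersetCard q := fun z hz => by
    rw [Finset.mem_filter] at hz
    exact Finset.mem_powersetCard.mpr ⟨hz.2, hB z hz.1⟩
  have h2 := Finset.card_le_card h1
  rw [Finset.card_powersetCard, hA x hx, Nat.choose_succ_self_right] at h2
  exact_mod_cast h2

lemma sum_superset_eq (X : FinComplex V) {A : Finset (Finset V)} (hA : A ⊆ X.faces)
    {z : Finset V} (hz : ∀ x ∈ A, x.card = z.card + 1) :
    ∑ x ∈ A with z ⊆ x, X.wt x =
      ∑ v ∈ X.vertices with v ∉ z ∧ insert v z ∈ A, X.wt (insert v z) := by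
  symm
  refine Finset.sum_bij (fun v _ => insert v z) ?_ ?_ ?_ (fun _ _ => rfl)
  · intro v hv
    rw [Finset.mem_filter] at hv
    exact Finset.mem_filter.mpr ⟨hv.2.2, Finset.subset_insert _ _⟩
  · intro a ha b hb hab
    rw [Finset.mem_filter] at ha hb
    have : a ∈ insert b z := hab ▸ Finset.mem_insert_self a z
    exact (Finset.mem_insert.mp this).resolve_right ha.2.1
  · intro x hx
    rw [Finset.mem_filter] at hx
    have hc : (x \ z).card = 1 := by
      rw [Finset.card_sdiff_of_subset hx.2, hz x hx.1]; omega
    obtain ⟨v, hv⟩ := Finset.card_eq_one.mp hc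
    have hv1 : v ∈ x \ z := hv ▸ Finset.mem_singleton_self v
    rw [Finset.mem_sdiff] at hv1
    have hx' : insert v z = x := by
      rw [Finset.insert_eq, ← hv, Finset.sdiff_union_of_subset hx.2]
    exact ⟨v, Finset.mem_filter.mpr ⟨X.subset_vertices x (hA hx.1) hv1.1, hv1.2, hx' ▸ hx.1⟩, hx'⟩

section Fat

variable {X : FinComplex V} {K : ℕ} {c : ℝ} {S : Finset (Finset V)}

lemma fat_subset (hS : S ⊆ X.faces) (r : ℕ) : X.fat K c S r ⊆ X.faces := by
  cases r with
  | zero => exact hS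
  | succ r => exact Finset.filter_subset _ _

lemma card_of_mem_fat (hK : ∀ x ∈ S, x.card = K) {r : ℕ} {x : Finset V}
    (hx : x ∈ X.fat K c S r) : x.card + r = K := by
  cases r with
  | zero => exact hK x hx
  | succ r => exact (Finset.mem_filter.mp hx).2.1

/-- Summing the fatness inequality over level `r + 1` counts each face of level `r` at most `q + 1`
times, and this factor cancels the `x.card + 1` in the threshold. -/
lemma sum_fat_succ_le (hK : ∀ x ∈ S, x.card = K) (r : ℕ) :
    (∑ x ∈ X.fat K c S (r + 1), X.wt x) * c ^ (2 ^ r) ≤ ∑ x ∈ X.fat K c S r, X.wt x := by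
  by_cases hr : r + 1 ≤ K
  swap
  · have : X.fat K c S (r + 1) = ∅ := Finset.eq_empty_of_forall_notMem fun x hx => by
      have := card_of_mem_fat hK hx
      omega
    rw [this, Finset.sum_empty, zero_mul]
    exact Finset.sum_nonneg fun x _ => X.wt_nonneg x
  obtain ⟨q, hq⟩ := Nat.exists_eq_add_of_le hr
  have hcard : ∀ x ∈ X.fat K c S (r + 1), x.card = q := fun x hx => by
    have := card_of_mem_fat hK hx
    omega
  have h1 := X.sum_sum_superset_le q (X.fat K c S r) (X.fat K c S (r + 1))
    (fun x hx => by have := card_of_mem_fat hK hx; omega) hcard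
  have h2 : ∑ x ∈ X.fat K c S (r + 1), c ^ (2 ^ r) * (q + 1) * X.wt x ≤
      ∑ z ∈ X.fat K c S (r + 1), ∑ x ∈ X.fat K c S r with z ⊆ x, X.wt x := by
    refine Finset.sum_le_sum fun x hx => ?_
    have := (Finset.mem_filter.mp hx).2.2
    rwa [hcard x hx] at this
  rw [← Finset.mul_sum] at h2
  have hq0 : (0 : ℝ) < q + 1 := by positivity
  refine le_of_mul_le_mul_left ?_ hq0
  calc _ = _ := by ring
    _ ≤ _ := h2.trans h1

/-- The exponents accumulate as `1 + 2 + ... + 2 ^ (r - 1) = 2 ^ r - 1`. -/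
lemma sum_fat_le (hc : 0 < c) (hK : ∀ x ∈ S, x.card = K) (r : ℕ) :
    (∑ x ∈ X.fat K c S r, X.wt x) * c ^ (2 ^ r - 1) ≤ ∑ x ∈ S, X.wt x := by
  induction r with
  | zero => simp [fat]
  | succ r ih =>
    have h1 : 2 ^ (r + 1) - 1 = 2 ^ r + (2 ^ r - 1) := by
      have := Nat.one_le_two_pow (n := r)
      rw [pow_succ]; omega
    rw [h1, pow_add, ← mul_assoc]
    exact (mul_le_mul_of_nonneg_right (sum_fat_succ_le hK r) (by positivity)).trans ih

/-- The empty face has weight `1`, and could only occur at level `K`, where the total weight is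
below `1`. The smallness threshold of the theorem comes from here. -/
lemma empty_notMem_fat {n : ℕ} (hX : X.IsPureCard n) (hc : 0 < c) (hK : ∀ x ∈ S, x.card = K)
    (hsmall : ∑ x ∈ S, X.wt x < c ^ (2 ^ K - 1)) (r : ℕ) : ∅ ∉ X.fat K c S r := by
  intro hmem
  have hr : r = K := by simpa using card_of_mem_fat hK hmem
  subst hr
  have h1 : (1 : ℝ) ≤ ∑ x ∈ X.fat r c S r, X.wt x := by
    rw [← hX.wt_empty]
    exact Finset.single_le_sum (f := X.wt) (fun x _ => X.wt_nonneg x) hmem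
  have h2 := sum_fat_le (X := X) hc hK r
  have h3 : 0 < c ^ (2 ^ r - 1) := by positivity
  nlinarith

/-- The unions of two fat faces that meet in a face of one dimension less that is not fat. -/
noncomputable def clash (X : FinComplex V) (K : ℕ) (c : ℝ) (S : Finset (Finset V)) (r : ℕ) :
    Finset (Finset V) :=
  X.faces.filter fun u => u.card + r = K + 1 ∧ ∃ x ∈ X.fat K c S r, ∃ x' ∈ X.fat K c S r,
    x ≠ x' ∧ x ∪ x' = u ∧ x ∩ x' ∉ X.fat K c S (r + 1)

lemma mem_clash {r : ℕ} {u : Finset V} : u ∈ X.clash K c S r ↔ u ∈ X.faces ∧ u.card + r = K + 1 ∧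
    ∃ x ∈ X.fat K c S r, ∃ x' ∈ X.fat K c S r,
      x ≠ x' ∧ x ∪ x' = u ∧ x ∩ x' ∉ X.fat K c S (r + 1) := by
  rw [clash, Finset.mem_filter]

/-- A set of vertices of a link spans few edges if it is small. -/
lemma FormLE.sum_sum_le {X : FinComplex V} {m : ℝ} (h : X.FormLE m) (hm : 0 ≤ m) {h' : ℝ}
    (hmh : m ≤ h') (U : Finset V) (hU : ∀ x ∈ X.faces, x ⊆ U) (T : Finset V) (hT : T ⊆ U)
    (hsmall : ∑ a ∈ T, X.wt {a} ≤ h') :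
    ∑ a ∈ T, ∑ b ∈ T, X.halfWt a b ≤ 2 * h' * ∑ a ∈ T, X.wt {a} := by
  have h1 := h U hU (fun a => if a ∈ T then 1 else 0)
  have e1 : ∑ a ∈ U, ∑ b ∈ U, X.halfWt a b * (if a ∈ T then 1 else 0) * (if b ∈ T then 1 else 0)
      = ∑ a ∈ T, ∑ b ∈ T, X.halfWt a b := by
    simp only [mul_ite, mul_one, mul_zero, Finset.sum_ite_mem, Finset.inter_eq_right.mpr hT]
    rw [← Finset.sum_subset hT]
    · exact Finset.sum_congr rfl fun a ha => by simp [ha]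
    · intro a _ ha
      simp [ha]
  have e2 : ∑ a ∈ U, X.wt {a} * (if a ∈ T then (1 : ℝ) else 0) ^ 2 = ∑ a ∈ T, X.wt {a} := by
    simp only [ite_pow, one_pow, ne_eq, OfNat.ofNat_ne_zero, not_false_eq_true, zero_pow, mul_ite,
      mul_one, mul_zero, Finset.sum_ite_mem, Finset.inter_eq_right.mpr hT]
  have e3 : ∑ a ∈ U, X.wt {a} * (if a ∈ T then (1 : ℝ) else 0) = ∑ a ∈ T, X.wt {a} := by
    simp only [mul_ite, mul_one, mul_zero, Finset.sum_ite_mem, Finset.inter_eq_right.mpr hT]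
  rw [e1, e2, e3] at h1
  set p := ∑ a ∈ T, X.wt {a}
  have hp : 0 ≤ p := Finset.sum_nonneg fun a _ => X.wt_nonneg _
  refine h1.trans ?_
  -- Both `m * p` and `(1 - m) * p ^ 2` are at most `h' * p`.
  nlinarith [mul_nonneg hm (mul_nonneg hp hp), mul_le_mul_of_nonneg_right hmh hp,
    mul_le_mul_of_nonneg_right hsmall hp]

end Fat

end FinComplex

lemma sum_biUnion_le {ι α : Type*} [DecidableEq α] (s : Finset ι) (t : ι → Finset α) {f : α → ℝ}
    (hf : ∀ a, 0 ≤ f a) : ∑ a ∈ s.biUnion t, f a ≤ ∑ i ∈ s, ∑ a ∈ t i, f a := by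
  have h : s.biUnion t = (s.sigma t).image fun p => p.2 := by
    ext a
    simp
  rw [h]
  refine (Finset.sum_image_le_of_nonneg fun a _ => hf a).trans (le_of_eq ?_)
  exact Finset.sum_sigma _ _ _

namespace FinComplex

variable {V : Type u} [LinearOrder V] {X : FinComplex V} {K : ℕ} {c : ℝ} {S : Finset (Finset V)}

lemma IsPureCard.wt_insert_insert {n : ℕ} (hX : X.IsPureCard n) (z : X.Face) {q : ℕ}
    (hq : z.1.card = q) {a b : V} (ha : a ∉ z.1) (hb : b ∉ z.1) :
    (if a = b then 0 else X.wt (insert a (insert b z.1))) =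
      (q + 1) * (q + 2) * X.wt z.1 * (X.link z).halfWt a b := by
  by_cases hab : a = b
  · rw [halfWt, if_pos hab, if_pos hab, mul_zero]
  rw [if_neg hab, halfWt, if_neg hab]
  have hd : Disjoint ({a, b} : Finset V) z.1 := by
    rw [Finset.disjoint_insert_left, Finset.disjoint_singleton_left]
    exact ⟨ha, hb⟩
  have h1 := hX.wt_union z hd
  rw [Finset.card_pair hab, hq, Finset.insert_union, ← Finset.insert_eq] at h1
  have h2 : (((2 + q).choose q : ℕ) : ℝ) * 2 = (q + 1) * (q + 2) := by
    have h3 : (2 + q).choose q = (q + 2).choose 2 := by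
      rw [add_comm, Nat.choose_symm_add]
    have h4 := Nat.add_one_mul_choose_eq (q + 1) 1
    rw [Nat.choose_one_right] at h4
    rw [h3]
    have h5 : ((q + 1 + 1) * (q + 1) : ℝ) = ((q + 2).choose 2 : ℕ) * 2 := by exact_mod_cast h4
    rw [← h5]; ring
  rw [h1, ← h2]
  ring

lemma IsPureCard.wt_insert {n : ℕ} (hX : X.IsPureCard n) (z : X.Face) {q : ℕ}
    (hq : z.1.card = q) {a : V} (ha : a ∉ z.1) :
    X.wt (insert a z.1) = (q + 1) * X.wt z.1 * (X.link z).wt {a} := by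
  have h1 := hX.wt_union z (Finset.disjoint_singleton_left.mpr ha)
  rw [Finset.card_singleton, hq, ← Finset.insert_eq, add_comm, Nat.choose_succ_self_right] at h1
  rw [h1]; push_cast; ring

lemma insert_of_card_inter {x z : Finset V} (hzx : z ⊆ x) (h : x.card = z.card + 1) :
    ∃ a, a ∉ z ∧ insert a z = x := by
  have hc : (x \ z).card = 1 := by
    rw [Finset.card_sdiff_of_subset hzx]; omega
  obtain ⟨v, hv⟩ := Finset.card_eq_one.mp hc
  have hv1 : v ∈ x \ z := hv ▸ Finset.mem_singleton_self v
  rw [Finset.mem_sdiff] at hv1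
  exact ⟨v, hv1.2, by rw [Finset.insert_eq, ← hv, Finset.sdiff_union_of_subset hzx]⟩

/-- The clashes at a face that is not fat have small weight. -/
lemma IsPureCard.sum_clash_at_le {n : ℕ} (hX : X.IsPureCard n) (hS : S ⊆ X.faces)
    (hK : ∀ x ∈ S, x.card = K) {m : ℝ} (hm : 0 ≤ m) {r q : ℕ} (hq : q + 1 + r = K)
    (hmr : m ≤ c ^ (2 ^ r)) (z : X.Face) (hform : (X.link z).FormLE m) (hz : z.1.card = q)
    (hfat : z.1 ∉ X.fat K c S (r + 1)) :
    ∑ a ∈ X.vertices with a ∉ z.1 ∧ insert a z.1 ∈ X.fat K c S r,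
      ∑ b ∈ X.vertices with b ∉ z.1 ∧ insert b z.1 ∈ X.fat K c S r,
        (if a = b then 0 else X.wt (insert a (insert b z.1))) ≤
      2 * (q + 2) * c ^ (2 ^ r) * ∑ x ∈ X.fat K c S r with z.1 ⊆ x, X.wt x := by
  set T : Finset V := X.vertices.filter fun a => a ∉ z.1 ∧ insert a z.1 ∈ X.fat K c S r with hT
  have hTz : ∀ a ∈ T, a ∉ z.1 := fun a ha => (Finset.mem_filter.mp ha).2.1
  have hsum : ∑ x ∈ X.fat K c S r with z.1 ⊆ x, X.wt x =
      (q + 1) * X.wt z.1 * ∑ a ∈ T, (X.link z).wt {a} := by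
    rw [X.sum_superset_eq (fat_subset hS r) fun x hx => by
      have := card_of_mem_fat hK hx
      omega, ← hT, Finset.mul_sum]
    exact Finset.sum_congr rfl fun a ha => hX.wt_insert z hz (hTz a ha)
  have hwz := hX.wt_pos z.2
  -- A larger measure would make `z` fat.
  have hsmall : ∑ a ∈ T, (X.link z).wt {a} ≤ c ^ (2 ^ r) := by
    by_contra hlt
    apply hfat
    refine Finset.mem_filter.mpr ⟨z.2, by omega, ?_⟩
    rw [hsum, hz]
    have := mul_le_mul_of_nonneg_left (not_le.mp hlt).le
      (mul_nonneg (by positivity : (0 : ℝ) ≤ q + 1) hwz.le)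
    linarith
  have hedge := hform.sum_sum_le hm hmr X.vertices
    (fun x hx => X.subset_vertices x (X.down_closed (mem_link.mp hx).2 Finset.subset_union_left))
    T (Finset.filter_subset _ _) hsmall
  have hlhs : ∑ a ∈ T, ∑ b ∈ T, (if a = b then 0 else X.wt (insert a (insert b z.1))) =
      (q + 1) * (q + 2) * X.wt z.1 * ∑ a ∈ T, ∑ b ∈ T, (X.link z).halfWt a b := by
    rw [Finset.mul_sum]
    refine Finset.sum_congr rfl fun a ha => ?_
    rw [Finset.mul_sum]
    exact Finset.sum_congr rfl fun b hb => hX.wt_insert_insert z hz (hTz a ha) (hTz b hb)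
  rw [hlhs, hsum]
  have := mul_le_mul_of_nonneg_left hedge
    (by positivity : (0 : ℝ) ≤ (q + 1) * (q + 2) * X.wt z.1)
  refine this.trans (le_of_eq ?_)
  ring

/-- A clash arises from a face `z` that is not fat by adding two distinct vertices `a`, `b`, each of
which alone makes `z` fat. The local bound is summed over all such `z`, and each fat face is then
counted at most `q + 1` times. -/
lemma IsPureCard.sum_clash_le {n : ℕ} (hX : X.IsPureCard n) (hS : S ⊆ X.faces)
    (hK : ∀ x ∈ S, x.card = K) (hKn : K + 1 ≤ n) (hc : 0 < c) {m : ℝ} (hm : 0 ≤ m) {r q : ℕ}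
    (hq : q + 1 + r = K) (hmr : m ≤ c ^ (2 ^ r))
    (hform : ∀ z : X.Face, z.1.card + 2 ≤ n → (X.link z).FormLE m) :
    ∑ u ∈ X.clash K c S r, X.wt u ≤
      2 * (q + 1) * (q + 2) * c ^ (2 ^ r) * ∑ x ∈ X.fat K c S r, X.wt x := by
  classical
  set A := X.fat K c S r with hA
  set B : Finset (Finset V) :=
    X.faces.filter fun z => z.card = q ∧ z ∉ X.fat K c S (r + 1) with hB
  set T : Finset V → Finset V := fun z => X.vertices.filter fun a => a ∉ z ∧ insert a z ∈ A with hT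
  have hcA : ∀ x ∈ A, x.card = q + 1 := fun x hx => by
    have := card_of_mem_fat hK hx
    omega
  set I : Finset ((_ : Finset V) × (V × V)) :=
    (B.sigma fun z => T z ×ˢ T z).filter fun t => t.2.1 ≠ t.2.2 with hI
  set φ : ((_ : Finset V) × (V × V)) → Finset V :=
    fun t => insert t.2.1 (insert t.2.2 t.1) with hφ
  have hsub : X.clash K c S r ⊆ I.image φ := by
    intro u hu
    obtain ⟨huX, huc, x, hx, x', hx', hne, hun, hnf⟩ := mem_clash.mp hu
    have h1 := Finset.card_union_add_card_inter x x'
    rw [hun, hcA x hx, hcA x' hx'] at h1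
    obtain ⟨a, haz, ha⟩ := insert_of_card_inter (Finset.inter_subset_left (s₁ := x) (s₂ := x'))
      (by rw [hcA x hx]; omega)
    obtain ⟨b, hbz, hb⟩ := insert_of_card_inter (Finset.inter_subset_right (s₁ := x) (s₂ := x'))
      (by rw [hcA x' hx']; omega)
    have hxX := fat_subset hS r hx
    have hxX' := fat_subset hS r hx'
    refine Finset.mem_image.mpr ⟨⟨x ∩ x', (a, b)⟩, ?_, ?_⟩
    · simp only [hI, Finset.mem_filter, Finset.mem_sigma, Finset.mem_product, hB, hT]
      refine ⟨⟨⟨X.down_closed hxX Finset.inter_subset_left, by omega, hnf⟩,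
        ⟨X.subset_vertices x hxX (ha ▸ Finset.mem_insert_self _ _), haz, by rw [ha]; exact hx⟩,
        ⟨X.subset_vertices x' hxX' (hb ▸ Finset.mem_insert_self _ _), hbz, by rw [hb]; exact hx'⟩⟩,
        ?_⟩
      intro hab
      exact hne (ha.symm.trans (hab ▸ hb))
    · simp only [hφ]
      rw [← hun]
      conv_rhs => rw [← ha, ← hb]
      ext v
      simp only [Finset.mem_insert, Finset.mem_inter, Finset.mem_union]
      tauto
  calc ∑ u ∈ X.clash K c S r, X.wt u
      ≤ ∑ u ∈ I.image φ, X.wt u :=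
        Finset.sum_le_sum_of_subset_of_nonneg hsub fun u _ _ => X.wt_nonneg u
    _ ≤ ∑ t ∈ I, X.wt (φ t) := Finset.sum_image_le_of_nonneg fun u _ => X.wt_nonneg u
    _ = ∑ z ∈ B, ∑ a ∈ T z, ∑ b ∈ T z,
          (if a = b then 0 else X.wt (insert a (insert b z))) := by
        rw [hI, Finset.sum_filter, Finset.sum_sigma]
        refine Finset.sum_congr rfl fun z _ => ?_
        rw [Finset.sum_product]
        refine Finset.sum_congr rfl fun a _ => Finset.sum_congr rfl fun b _ => ?_
        simp only [hφ, ne_eq, ite_not]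
    _ ≤ ∑ z ∈ B, 2 * (q + 2) * c ^ (2 ^ r) * ∑ x ∈ A with z ⊆ x, X.wt x := by
        refine Finset.sum_le_sum fun z hz => ?_
        simp only [hB, Finset.mem_filter] at hz
        exact hX.sum_clash_at_le hS hK hm hq hmr ⟨z, hz.1⟩
          (hform ⟨z, hz.1⟩ (by simp only [hz.2.1]; omega)) hz.2.1 hz.2.2
    _ ≤ 2 * (q + 2) * c ^ (2 ^ r) * ((q + 1) * ∑ x ∈ A, X.wt x) := by
        rw [← Finset.mul_sum]
        refine mul_le_mul_of_nonneg_left ?_ (by positivity)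
        exact X.sum_sum_superset_le q A B hcA fun z hz => (Finset.mem_filter.mp hz).2.1
    _ = _ := by ring

/-- The faces of dimension one more than those of `S` that contain a clash. -/
noncomputable def bad (X : FinComplex V) (K : ℕ) (c : ℝ) (S : Finset (Finset V)) :
    Finset (Finset V) :=
  X.faces.filter fun y => y.card = K + 1 ∧ ∃ r ∈ Finset.range K, ∃ u ∈ X.clash K c S r, u ⊆ y

lemma IsPureCard.sum_bad_le {n : ℕ} (hX : X.IsPureCard n) (hS : S ⊆ X.faces)
    (hK : ∀ x ∈ S, x.card = K) (hKn : K + 1 ≤ n) (hc : 0 < c) {m : ℝ} (hm : 0 ≤ m)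
    (hmr : ∀ r < K, m ≤ c ^ (2 ^ r))
    (hform : ∀ z : X.Face, z.1.card + 2 ≤ n → (X.link z).FormLE m) :
    ∑ y ∈ X.bad K c S, X.wt y ≤ (K : ℝ) ^ 2 * 2 ^ (K + 1) * c * ∑ x ∈ S, X.wt x := by
  classical
  have h1 : ∑ y ∈ X.bad K c S, X.wt y ≤ ∑ r ∈ Finset.range K, ∑ u ∈ X.clash K c S r,
      ∑ y ∈ X.faces with y.card = K + 1 ∧ u ⊆ y, X.wt y := by
    have hsub : X.bad K c S ⊆ (Finset.range K).biUnion fun r => (X.clash K c S r).biUnion fun u =>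
        X.faces.filter fun y => y.card = K + 1 ∧ u ⊆ y := by
      intro y hy
      obtain ⟨hyX, hyc, r, hr, u, hu, huy⟩ := Finset.mem_filter.mp hy
      exact Finset.mem_biUnion.mpr ⟨r, hr, Finset.mem_biUnion.mpr
        ⟨u, hu, Finset.mem_filter.mpr ⟨hyX, hyc, huy⟩⟩⟩
    refine (Finset.sum_le_sum_of_subset_of_nonneg hsub fun y _ _ => X.wt_nonneg y).trans ?_
    refine (sum_biUnion_le _ _ X.wt_nonneg).trans (Finset.sum_le_sum fun r _ => ?_)
    exact sum_biUnion_le _ _ X.wt_nonneg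
  refine h1.trans ?_
  have hw : 0 ≤ ∑ x ∈ S, X.wt x := Finset.sum_nonneg fun x _ => X.wt_nonneg x
  have h2 : ∀ r ∈ Finset.range K, ∑ u ∈ X.clash K c S r,
      ∑ y ∈ X.faces with y.card = K + 1 ∧ u ⊆ y, X.wt y ≤
      2 * ((K + 1) * K * ((K - 1).choose r : ℕ)) * (c * ∑ x ∈ S, X.wt x) := by
    intro r hr
    rw [Finset.mem_range] at hr
    obtain ⟨q, hq⟩ : ∃ q, q + 1 + r = K := ⟨K - 1 - r, by omega⟩
    have e1 : ∀ u ∈ X.clash K c S r, ∑ y ∈ X.faces with y.card = K + 1 ∧ u ⊆ y, X.wt y =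
        ((K + 1).choose r : ℕ) * X.wt u := by
      intro u hu
      have huc := (mem_clash.mp hu).2.1
      rw [hX.sum_wt u (by omega) hKn, ← Nat.choose_symm_of_eq_add huc.symm]
    have e2 : ((K + 1).choose r : ℝ) * ((q + 1) * (q + 2)) =
        (K + 1) * K * ((K - 1).choose r : ℕ) := by
      have i1 := Nat.choose_mul_succ_eq K r
      have i2 := Nat.choose_mul_succ_eq (K - 1) r
      rw [show K - 1 + 1 = K by omega, show K - r = q + 1 by omega] at i2
      rw [show K + 1 - r = q + 2 by omega] at i1
      have i1' : (K.choose r : ℝ) * (K + 1) = (K + 1).choose r * (q + 2) := by exact_mod_cast i1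
      have i2' : ((K - 1).choose r : ℝ) * K = K.choose r * (q + 1) := by exact_mod_cast i2
      linear_combination (-(K + 1 : ℝ)) * i2' - (q + 1 : ℝ) * i1'
    -- The reason for doubling exponents: passing to level `r` loses `c ^ (2 ^ r - 1)`, so the
    -- factor `c ^ (2 ^ r)` still leaves one `c`, at every level.
    have e3 : c ^ (2 ^ r) * ∑ x ∈ X.fat K c S r, X.wt x ≤ c * ∑ x ∈ S, X.wt x := by
      have h3 := mul_le_mul_of_nonneg_left (sum_fat_le (X := X) hc hK r) hc.le
      have h4 : 2 ^ r = (2 ^ r - 1) + 1 := by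
        have := Nat.one_le_two_pow (n := r)
        omega
      rw [h4, pow_succ]
      linarith
    rw [Finset.sum_congr rfl e1, ← Finset.mul_sum]
    calc ((K + 1).choose r : ℝ) * ∑ u ∈ X.clash K c S r, X.wt u
        ≤ (K + 1).choose r * (2 * (q + 1) * (q + 2) * c ^ (2 ^ r) *
            ∑ x ∈ X.fat K c S r, X.wt x) :=
          mul_le_mul_of_nonneg_left (hX.sum_clash_le hS hK hKn hc hm hq (hmr r hr) hform)
            (Nat.cast_nonneg _)
      _ = 2 * (((K + 1).choose r : ℝ) * ((q + 1) * (q + 2))) *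
            (c ^ (2 ^ r) * ∑ x ∈ X.fat K c S r, X.wt x) := by ring
      _ ≤ 2 * (((K + 1).choose r : ℝ) * ((q + 1) * (q + 2))) * (c * ∑ x ∈ S, X.wt x) :=
          mul_le_mul_of_nonneg_left e3 (by positivity)
      _ = _ := by rw [e2]
  refine (Finset.sum_le_sum h2).trans ?_
  rw [← Finset.sum_mul, ← Finset.mul_sum, ← Finset.mul_sum]
  have hcw := mul_nonneg hc.le hw
  rcases Nat.eq_zero_or_pos K with rfl | hKpos
  · simp
  have h3 : ∑ r ∈ Finset.range K, (((K - 1).choose r : ℕ) : ℝ) = 2 ^ (K - 1) := by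
    have := Nat.sum_range_choose (K - 1)
    rw [show K - 1 + 1 = K by omega] at this
    exact_mod_cast this
  have h4 : (2 : ℝ) ^ (K + 1) = 2 ^ (K - 1) * 4 := by
    rw [show K + 1 = K - 1 + 2 by omega, pow_add]; norm_num
  have h5 : (1 : ℝ) ≤ K := by exact_mod_cast hKpos
  rw [h3, h4, show (K : ℝ) ^ 2 * (2 ^ (K - 1) * 4) * c * ∑ x ∈ S, X.wt x =
    ((K : ℝ) ^ 2 * (2 ^ (K - 1) * 4)) * (c * ∑ x ∈ S, X.wt x) by ring]
  refine mul_le_mul_of_nonneg_right ?_ hcw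
  have h6 : (0 : ℝ) < 2 ^ (K - 1) := by positivity
  -- This is `K + 1 ≤ 2 * K`, multiplied by `2 * K * 2 ^ (K - 1)`.
  nlinarith [mul_nonneg h6.le (mul_nonneg (sub_nonneg.mpr h5) (Nat.cast_nonneg (α := ℝ) K))]

end FinComplex

/-! ### Confluence of the descent through fat faces. -/

namespace FinComplex

variable {V : Type u} [LinearOrder V] {X : FinComplex V} {K : ℕ} {c : ℝ} {S : Finset (Finset V)}

/-- `x'` is a fat face of the fat face `x`, of one dimension less. -/
def Descends (X : FinComplex V) (K : ℕ) (c : ℝ) (S : Finset (Finset V)) (x x' : Finset V) : Prop :=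
  ∃ r, x ∈ X.fat K c S r ∧ x' ∈ X.fat K c S (r + 1) ∧ x' ⊆ x

/-- `z` is a fat face none of whose faces of one dimension less is fat. -/
def IsTerminal (X : FinComplex V) (K : ℕ) (c : ℝ) (S : Finset (Finset V)) (z : Finset V) : Prop :=
  (∃ r, z ∈ X.fat K c S r) ∧ ∀ x, ¬ X.Descends K c S z x

lemma reflTransGen_descends_subset {x z : Finset V}
    (h : Relation.ReflTransGen (X.Descends K c S) x z) : z ⊆ x := by
  induction h with
  | refl => exact subset_rfl
  | tail _ h ih =>
    obtain ⟨r, -, -, hsub⟩ := h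
    exact hsub.trans ih

lemma exists_isTerminal (hK : ∀ x ∈ S, x.card = K) {r : ℕ} {x : Finset V}
    (hx : x ∈ X.fat K c S r) :
    ∃ z, X.IsTerminal K c S z ∧ Relation.ReflTransGen (X.Descends K c S) x z := by
  have hr := card_of_mem_fat hK hx
  obtain ⟨q, hq⟩ : ∃ q, q = x.card := ⟨_, rfl⟩
  induction q generalizing x r with
  | zero =>
    refine ⟨x, ⟨⟨r, hx⟩, ?_⟩, .refl⟩
    rintro x' ⟨r', h1, h2, h3⟩
    have := card_of_mem_fat hK h1
    have := card_of_mem_fat hK h2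
    omega
  | succ q ih =>
    by_cases ht : ∃ x', X.Descends K c S x x'
    · obtain ⟨x', r', h1, h2, h3⟩ := ht
      have e1 := card_of_mem_fat hK h1
      have e2 := card_of_mem_fat hK h2
      obtain ⟨z, hz, hxz⟩ := ih h2 e2 (by omega)
      exact ⟨z, hz, .head ⟨r', h1, h2, h3⟩ hxz⟩
    · exact ⟨x, ⟨⟨r, hx⟩, not_exists.mp ht⟩, .refl⟩

/-- Otherwise `b ∪ b'` would be a clash inside `y`. -/
lemma inter_mem_fat_of_notMem_bad (hK : ∀ x ∈ S, x.card = K) {y : Finset V}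
    (hy : y ∈ X.faces) (hyc : y.card = K + 1) (hgood : y ∉ X.bad K c S) {r : ℕ} {b b' : Finset V}
    (hb : b ∈ X.fat K c S r) (hb' : b' ∈ X.fat K c S r) (hne : b ≠ b') (hsub : b ∪ b' ⊆ y)
    (hcard : (b ∪ b').card = b.card + 1) : b ∩ b' ∈ X.fat K c S (r + 1) := by
  by_contra hn
  have e1 := card_of_mem_fat hK hb
  have e2 := card_of_mem_fat hK hb'
  -- Ensures `r < K`, the range of levels in the definition of `bad`.
  have hpos : 0 < b.card := by
    rw [Nat.pos_iff_ne_zero]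
    intro h0
    have h1 : b = ∅ := Finset.card_eq_zero.mp h0
    have h2 : b' = ∅ := Finset.card_eq_zero.mp (by omega)
    exact hne (h1.trans h2.symm)
  exact hgood (Finset.mem_filter.mpr ⟨hy, hyc, r, Finset.mem_range.mpr (by omega), b ∪ b',
    mem_clash.mpr ⟨X.down_closed hy hsub, by omega, b, hb, b', hb', hne, rfl, hn⟩, hsub⟩)

lemma card_union_of_ne {a b b' : Finset V} (hb : b ⊆ a) (hb' : b' ⊆ a) (hne : b ≠ b')
    (h : b.card + 1 = a.card) (h' : b'.card = b.card) : b ∪ b' = a := by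
  refine Finset.eq_of_subset_of_card_le (Finset.union_subset hb hb') ?_
  have h1 : b ⊂ b ∪ b' := by
    refine Finset.ssubset_iff_subset_ne.mpr ⟨Finset.subset_union_left, fun heq => hne ?_⟩
    have h2 : b' ⊆ b := by
      rw [heq]
      exact Finset.subset_union_right
    exact (Finset.eq_of_subset_of_card_le h2 h'.ge).symm
  have := Finset.card_lt_card h1
  omega

/-- In a face without clashes, all chains of fat faces end at the same terminal face. -/
lemma IsTerminal.unique (hK : ∀ x ∈ S, x.card = K) {y : Finset V}
    (hy : y ∈ X.faces) (hyc : y.card = K + 1) (hgood : y ∉ X.bad K c S) {x z z' : Finset V}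
    (hxy : x ⊆ y) (hz : X.IsTerminal K c S z) (hz' : X.IsTerminal K c S z')
    (hxz : Relation.ReflTransGen (X.Descends K c S) x z)
    (hxz' : Relation.ReflTransGen (X.Descends K c S) x z') : z = z' := by
  set R : Finset V → Finset V → Prop := fun a b => a ⊆ y ∧ X.Descends K c S a b with hR
  have hlift : ∀ w, Relation.ReflTransGen (X.Descends K c S) x w →
      Relation.ReflTransGen R x w := by
    intro w hw
    induction hw with
    | refl => exact .refl
    | tail h1 h2 ih => exact ih.tail ⟨(reflTransGen_descends_subset h1).trans hxy, h2⟩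
  -- The diamond property: two different fat faces `b`, `b'` of `a`, of one dimension less, have
  -- union `a`, so in the absence of clashes `b ∩ b'` is fat and is a common descendant.
  have hcr : ∀ a b b', R a b → R a b' →
      ∃ w, Relation.ReflGen R b w ∧ Relation.ReflTransGen R b' w := by
    rintro a b b' ⟨hay, r, har, hbr, hba⟩ ⟨-, r', har', hbr', hba'⟩
    have e1 := card_of_mem_fat hK har
    have e2 := card_of_mem_fat hK har'
    obtain rfl : r = r' := by omega
    by_cases hbb : b = b'
    · exact ⟨b, .refl, hbb ▸ .refl⟩
    have e3 := card_of_mem_fat hK hbr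
    have e4 := card_of_mem_fat hK hbr'
    have hun := card_union_of_ne hba hba' hbb (by omega) (by omega)
    have hmem := inter_mem_fat_of_notMem_bad hK hy hyc hgood hbr hbr' hbb (by rwa [hun])
      (by rw [hun]; omega)
    exact ⟨b ∩ b', .single ⟨hba.trans hay, r + 1, hbr, hmem, Finset.inter_subset_left⟩,
      .single ⟨hba'.trans hay, r + 1, hbr', hmem, Finset.inter_subset_right⟩⟩
  obtain ⟨w, h1, h2⟩ := Relation.church_rosser hcr (hlift z hxz) (hlift z' hxz')
  have key : ∀ t, X.IsTerminal K c S t → Relation.ReflTransGen R t w → t = w := by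
    intro t ht htw
    rcases Relation.ReflTransGen.cases_head htw with h | ⟨s, hs, -⟩
    · exact h
    · exact absurd hs.2 (ht.2 s)
  exact (key z hz h1).trans (key z' hz' h2).symm

/-- If `x ≠ x'`, their intersection is fat and descends to some terminal face, which both of them
reach; by uniqueness it is `z`. -/
lemma IsTerminal.reach (hK : ∀ x ∈ S, x.card = K) {y : Finset V}
    (hy : y ∈ X.faces) (hyc : y.card = K + 1) (hgood : y ∉ X.bad K c S) {x x' z : Finset V}
    (hx : x ∈ S) (hx' : x' ∈ S) (hxy : x ⊆ y) (hxy' : x' ⊆ y) (hz : X.IsTerminal K c S z)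
    (hxz : Relation.ReflTransGen (X.Descends K c S) x z) :
    Relation.ReflTransGen (X.Descends K c S) x' z := by
  by_cases hne : x = x'
  · exact hne ▸ hxz
  have hun := card_union_of_ne hxy hxy' hne (by rw [hK x hx, hyc]) (by rw [hK x hx, hK x' hx'])
  have hmem := inter_mem_fat_of_notMem_bad (r := 0) hK hy hyc hgood hx hx' hne (by rw [hun])
    (by rw [hun, hyc, hK x hx])
  obtain ⟨w, hw, hreach⟩ := exists_isTerminal hK hmem
  have h1 : z = w := IsTerminal.unique hK hy hyc hgood hxy hz hw hxz
    (.head ⟨0, hx, hmem, Finset.inter_subset_left⟩ hreach)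
  rw [h1]
  exact .head ⟨0, hx', hmem, Finset.inter_subset_right⟩ hreach

end FinComplex

/-! ### Decomposition along terminal faces, and expansion of small locally minimal cochains. -/

namespace AugSheaf

variable {V : Type u} [LinearOrder V] {X : FinComplex V} (F : AugSheaf.{u, v} X)

lemma d_congr {f g : F.Cochain} {y : X.Face}
    (h : ∀ a ∈ y.1, f (removeVertex y a) = g (removeVertex y a)) : F.d f y = F.d g y := by
  rw [d_apply, d_apply]
  exact Finset.sum_congr rfl fun a _ => by rw [h a.1 a.2]

lemma exists_of_d_ne_zero {f : F.Cochain} {y : X.Face} (h : F.d f y ≠ 0) :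
    ∃ x : X.Face, x.1 ⊆ y.1 ∧ f x ≠ 0 := by
  by_contra! hn
  apply h
  rw [F.d_congr (g := 0) fun a _ => hn _ (Finset.erase_subset _ _), map_zero]
  rfl

open Classical in
/-- The support of a cochain, as a set of sets of vertices. -/
noncomputable def support (f : F.Cochain) : Finset (Finset V) :=
  (Finset.univ.filter fun x : X.Face => f x ≠ 0).image Subtype.val

variable {F}

lemma mem_support {f : F.Cochain} {x : X.Face} : x.1 ∈ F.support f ↔ f x ≠ 0 := by
  classical
  simp only [support, Finset.mem_image, Finset.mem_filter, Finset.mem_univ, true_and]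
  exact ⟨fun ⟨a, ha, hax⟩ => Subtype.ext hax ▸ ha, fun h => ⟨x, h, rfl⟩⟩

lemma support_subset (f : F.Cochain) : F.support f ⊆ X.faces := by
  classical
  intro x hx
  simp only [support, Finset.mem_image] at hx
  obtain ⟨a, -, rfl⟩ := hx
  exact a.2

lemma card_of_mem_support {k : ℕ} {f : F.Cochain} (hf : f ∈ F.C k) :
    ∀ x ∈ F.support f, x.card = k + 1 := by
  intro x hx
  have h1 : f ⟨x, support_subset f hx⟩ ≠ 0 := mem_support.mp hx
  by_contra hc
  exact h1 (hf _ (by simp only [Face.dim]; omega))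

lemma norm_eq_sum_support (f : F.Cochain) : F.norm f = ∑ x ∈ F.support f, X.wt x := by
  classical
  rw [norm_eq_sum, support, Finset.sum_image fun a _ b _ h => Subtype.ext h]
  exact Finset.sum_congr rfl fun x _ => X.weight_eq_wt x

open Classical in
/-- The part of `f` that lives on the faces from which `z` is reached by a chain of fat faces. -/
noncomputable def ladderPart (K : ℕ) (c : ℝ) (f : F.Cochain) (z : X.Face) : F.Cochain := fun x =>
  if Relation.ReflTransGen (X.Descends K c (F.support f)) x.1 z.1 then f x else 0

-- The comparison is made at each `y`. On a bad `y` a nonzero contribution requires `z ⊆ y`, leaving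
-- at most `2 ^ (k + 2)` terms. On a good `y` at most one part has nonzero coboundary, and that part
-- agrees with `f` on all faces of `y` of one dimension less.
open Classical in
lemma sum_norm_d_ladderPart_le {k : ℕ} (c : ℝ) {f : F.Cochain} (hf : f ∈ F.C k) :
    ∑ z : X.Face with X.IsTerminal (k + 1) c (F.support f) z.1,
      F.norm (F.d (ladderPart (k + 1) c f z)) ≤
    F.norm (F.d f) + 2 ^ (k + 2) * ∑ y ∈ X.bad (k + 1) c (F.support f), X.wt y := by
  set S := F.support f with hSdef
  set T : Finset X.Face := Finset.univ.filter fun z => X.IsTerminal (k + 1) c S z.1 with hT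
  have hS : S ⊆ X.faces := support_subset f
  have hK : ∀ x ∈ S, x.card = k + 1 := card_of_mem_support hf
  have hpart : ∀ z : X.Face, ladderPart (k + 1) c f z ∈ F.C k := by
    intro z x hx
    unfold ladderPart
    split_ifs
    exacts [hf x hx, rfl]
  have hne : ∀ {z x : X.Face}, ladderPart (k + 1) c f z x ≠ 0 →
      x.1 ∈ S ∧ Relation.ReflTransGen (X.Descends (k + 1) c S) x.1 z.1 := by
    intro z x h
    unfold ladderPart at h
    split_ifs at h with h1
    · exact ⟨mem_support.mpr h, h1⟩
    · exact absurd rfl h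
  have hbad : ∑ y ∈ X.bad (k + 1) c S, X.wt y =
      ∑ y : X.Face, if y.1 ∈ X.bad (k + 1) c S then X.weight y else 0 := by
    rw [← Finset.sum_filter, sum_face_filter fun y => y ∈ X.bad (k + 1) c S]
    refine Finset.sum_congr ?_ fun _ _ => rfl
    ext y
    rw [Finset.mem_filter]
    exact ⟨fun h => ⟨(Finset.mem_filter.mp h).1, h⟩, fun h => h.2⟩
  unfold norm
  rw [Finset.sum_comm, hbad, Finset.mul_sum, ← Finset.sum_add_distrib]
  refine Finset.sum_le_sum fun y _ => ?_
  by_cases hyc : y.1.card = k + 2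
  swap
  · rw [Finset.sum_eq_zero]
    · have := F.secNorm_nonneg y (F.d f y)
      have := weight_nonneg y
      split_ifs <;> positivity
    · intro z _
      rw [d_mem (hpart z) y (by simp only [Face.dim]; omega), secNorm_zero]
  by_cases hyb : y.1 ∈ X.bad (k + 1) c S
  · rw [if_pos hyb]
    refine le_trans ?_ (le_add_of_nonneg_left (F.secNorm_nonneg y _))
    have h1 : ∑ z ∈ T, F.secNorm y (F.d (ladderPart (k + 1) c f z) y) ≤
        ∑ z ∈ T, if z.1 ⊆ y.1 then X.weight y else 0 := by
      refine Finset.sum_le_sum fun z _ => ?_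
      split_ifs with hzy
      · exact F.secNorm_le _ _
      · by_cases h0 : F.d (ladderPart (k + 1) c f z) y = 0
        · rw [h0, secNorm_zero]
        · obtain ⟨x, hxy, hx⟩ := F.exists_of_d_ne_zero h0
          exact absurd ((reflTransGen_descends_subset (hne hx).2).trans hxy) hzy
    refine h1.trans ?_
    rw [← Finset.sum_filter, Finset.sum_const, nsmul_eq_mul]
    refine mul_le_mul_of_nonneg_right ?_ (weight_nonneg y)
    have h2 : (T.filter fun z => z.1 ⊆ y.1).card ≤ y.1.powerset.card := by
      refine Finset.card_le_card_of_injOn Subtype.val ?_ (fun a _ b _ h => Subtype.ext h)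
      intro z hz
      exact Finset.mem_coe.mpr (Finset.mem_powerset.mpr
        (Finset.mem_filter.mp (Finset.mem_coe.mp hz)).2)
    rw [Finset.card_powerset, hyc] at h2
    exact_mod_cast h2
  · rw [if_neg hyb, mul_zero, add_zero]
    by_cases hall : ∀ z ∈ T, F.d (ladderPart (k + 1) c f z) y = 0
    · rw [Finset.sum_eq_zero fun z hz => by rw [hall z hz, secNorm_zero]]
      exact F.secNorm_nonneg y _
    push Not at hall
    obtain ⟨z, hzT, hz⟩ := hall
    have hzt := (Finset.mem_filter.mp hzT).2
    obtain ⟨x, hxy, hx⟩ := F.exists_of_d_ne_zero hz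
    rw [Finset.sum_eq_single_of_mem z hzT]
    · rw [F.d_congr (g := f)]
      intro a _
      by_cases h0 : f (removeVertex y a) = 0
      · unfold ladderPart
        split_ifs
        exacts [rfl, h0.symm]
      · exact if_pos (hzt.reach hK y.2 hyc hyb (hne hx).1 (mem_support.mpr h0) hxy
          (Finset.erase_subset _ _) (hne hx).2)
    · intro z' hzT' hzz'
      by_contra h0
      have h1 : F.d (ladderPart (k + 1) c f z') y ≠ 0 := fun h => h0 (by rw [h, secNorm_zero])
      obtain ⟨x', hxy', hx'⟩ := F.exists_of_d_ne_zero h1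
      have h2 := hzt.reach hK y.2 hyc hyb (hne hx).1 (hne hx').1 hxy hxy' (hne hx).2
      exact hzz' (Subtype.ext (IsTerminal.unique hK y.2 hyc hyb hxy'
        (Finset.mem_filter.mp hzT').2 hzt (hne hx').2 h2))

/-- Local coboundary expansion and spectral expansion of the links imply expansion of small locally
minimal cochains. -/
theorem expands_of_link {n k : ℕ} (hX : X.IsPureCard n) (hkn : k + 2 ≤ n) {e : ℝ} (he : 0 < e)
    {m : ℝ} (hm : 0 ≤ m)
    (hmr : ∀ r < k + 1, m ≤ (e / (((k : ℝ) + 1) ^ 2 * 2 ^ (2 * k + 6))) ^ (2 ^ r))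
    (hform : ∀ z : X.Face, z.1.card + 2 ≤ n → (X.link z).FormLE m)
    (hF : ∀ x : X.Face, x.1.card = k + 1 ∨ x.1.card = k + 2 → Nontrivial (F.sec x))
    (hloc : ∀ (z : X.Face) (j : ℕ), j ≤ k → z.1.card = j + 1 → ∃ ε,
      (F.link z).IsCoboundaryExpander ((k : ℤ) - j - 1) ε ∧
        e ≤ ((k : ℝ) + 2) * ε / ((k : ℝ) + 1 - j)) :
    F.Expands k (e / 2) ((e / (((k : ℝ) + 1) ^ 2 * 2 ^ (2 * k + 6))) ^ (2 ^ (k + 1) - 1)) := by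
  classical
  intro f hf hmin hsmall
  set c : ℝ := e / (((k : ℝ) + 1) ^ 2 * 2 ^ (2 * k + 6)) with hcdef
  have hc : 0 < c := by positivity
  have hS : F.support f ⊆ X.faces := support_subset f
  have hK : ∀ x ∈ F.support f, x.card = k + 1 := card_of_mem_support hf
  set T : Finset X.Face :=
    Finset.univ.filter fun z => X.IsTerminal (k + 1) c (F.support f) z.1 with hT
  have hlower : F.norm f ≤ ∑ z ∈ T, F.norm (ladderPart (k + 1) c f z) := by
    unfold norm
    rw [Finset.sum_comm]
    refine Finset.sum_le_sum fun x _ => ?_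
    by_cases hx : f x = 0
    · rw [hx, secNorm_zero]
      exact Finset.sum_nonneg fun z _ => F.secNorm_nonneg _ _
    · have hxS : x.1 ∈ X.fat (k + 1) c (F.support f) 0 := mem_support.mpr hx
      obtain ⟨z, hz, hxz⟩ := exists_isTerminal hK hxS
      obtain ⟨r, hr⟩ := hz.1
      set z' : X.Face := ⟨z, fat_subset hS r hr⟩
      have h1 : ladderPart (k + 1) c f z' x = f x := if_pos hxz
      rw [← h1]
      exact Finset.single_le_sum (f := fun z => F.secNorm x (ladderPart (k + 1) c f z x))
        (fun z _ => F.secNorm_nonneg _ _) (Finset.mem_filter.mpr ⟨Finset.mem_univ z', hz⟩)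
  have hexp : ∀ z ∈ T, e * F.norm (ladderPart (k + 1) c f z) ≤
      F.norm (F.d (ladderPart (k + 1) c f z)) := by
    intro z hz
    obtain ⟨⟨r, hr⟩, -⟩ := (Finset.mem_filter.mp hz).2
    have hzc := card_of_mem_fat hK hr
    -- The smallness of `f` enters here: the local hypotheses say nothing about the empty face.
    have hz0 : z.1.card ≠ 0 := by
      intro h0
      rw [Finset.card_eq_zero.mp h0] at hr
      exact empty_notMem_fat hX hc hK (norm_eq_sum_support f ▸ hsmall) r hr
    obtain ⟨j, hj⟩ := Nat.exists_eq_succ_of_ne_zero hz0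
    obtain ⟨ε, hε, heε⟩ := hloc z j (by omega) hj
    have hminz : F.IsLocallyMinimalAt k f z := by
      by_cases hjk : z.dim ≤ (k : ℤ) - 1
      · exact hmin z (by simp only [Face.dim]; omega) hjk
      · exact isLocallyMinimalAt_of_dim F f (by omega)
    refine le_trans (mul_le_mul_of_nonneg_right heε (F.norm_nonneg _)) ?_
    refine hminz.le_norm_d hX hkn hj (by omega) hε hF hf (fun x => ?_) (fun y hy => ?_)
    · unfold ladderPart
      split_ifs
      exacts [Or.inl rfl, Or.inr rfl]
    · exact if_neg fun h => hy (reflTransGen_descends_subset h)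
  have hbad := hX.sum_bad_le hS hK (by omega) hc hm hmr hform
  rw [← norm_eq_sum_support] at hbad
  have hupper := sum_norm_d_ladderPart_le c hf
  have h1 : e * F.norm f ≤ ∑ z ∈ T, F.norm (F.d (ladderPart (k + 1) c f z)) := by
    refine (mul_le_mul_of_nonneg_left hlower he.le).trans ?_
    rw [Finset.mul_sum]
    exact Finset.sum_le_sum hexp
  -- The value of `c` makes the bad faces cost a quarter of `e * F.norm f`, more than enough for the
  -- constant `e / 2`.
  have h2 : (2 : ℝ) ^ (k + 2) * (((k + 1 : ℕ) : ℝ) ^ 2 * 2 ^ (k + 1 + 1) * c * F.norm f) =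
      e / 4 * F.norm f := by
    have h3 : (2 : ℝ) ^ (2 * k + 6) = 2 ^ (k + 2) * 2 ^ (k + 1 + 1) * 4 := by
      rw [← pow_add, show 2 * k + 6 = k + 2 + (k + 1 + 1) + 2 by ring, pow_add _ _ 2]
      norm_num
    rw [hcdef, h3]
    push_cast
    field_simp
  have h4 := mul_le_mul_of_nonneg_left hbad (by positivity : (0 : ℝ) ≤ 2 ^ (k + 2))
  have h5 := mul_nonneg he.le (F.norm_nonneg f)
  linarith

end AugSheaf

/-! ### From small locally minimal cochains to cosystolic expansion. -/

namespace AugSheaf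

variable {V : Type u} [LinearOrder V] {X : FinComplex V} {F : AugSheaf.{u, v} X}

lemma d_mem_natCast {k : ℕ} {f : F.Cochain} (hf : f ∈ F.C k) : F.d f ∈ F.C ((k + 1 : ℕ) : ℤ) := by
  rw [Nat.cast_succ]
  exact d_mem hf

/-- The norm depends only on the support. Infima over cosets are therefore attained, even if the
groups are infinite. -/
lemma finite_range_norm : (Set.range F.norm).Finite := by
  refine (X.faces.powerset.finite_toSet.image fun S => ∑ x ∈ S, X.wt x).subset ?_
  rintro _ ⟨f, rfl⟩
  exact ⟨F.support f, Finset.mem_coe.mpr (Finset.mem_powerset.mpr (support_subset f)),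
    (norm_eq_sum_support f).symm⟩

lemma exists_norm_minimal (H : AddSubgroup F.Cochain) (f : F.Cochain) :
    ∃ h ∈ H, ∀ h' ∈ H, F.norm (f + h) ≤ F.norm (f + h') := by
  obtain ⟨r, ⟨h, hh, rfl⟩, hmin⟩ := Set.exists_min_image ((fun h => F.norm (f + h)) '' H) id
    (finite_range_norm.subset (by rintro _ ⟨h, -, rfl⟩; exact ⟨_, rfl⟩))
    ⟨_, ⟨0, H.zero_mem, rfl⟩⟩
  exact ⟨h, hh, fun h' hh' => hmin _ ⟨h', hh', rfl⟩⟩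

/-- If small locally minimal cochains expand, then cocycles that are not coboundaries are large. -/
lemma Expands.le_norm_of_mem_Z {n : ℕ} (hX : X.IsPureCard n) {k : ℤ} {β α : ℝ} (hβ : 0 < β)
    (h : F.Expands k β α) {f : F.Cochain} (hf : f ∈ F.Z k) (hfB : f ∉ F.B k) : α ≤ F.norm f := by
  by_contra! hlt
  obtain ⟨b, hb, hmin⟩ := exists_norm_minimal (F.B k) f
  obtain ⟨b', hb', rfl⟩ := id hb
  have hdb : F.d b' ∈ F.C k := by
    have := d_mem (SetLike.mem_coe.mp hb')
    rwa [sub_add_cancel] at this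
  have hC : f + F.d b' ∈ F.C k := AddSubgroup.add_mem _ hf.1 hdb
  -- Local minimality tests only against coboundaries, and this representative is the shortest
  -- modulo all of them.
  have hlm : F.IsLocallyMinimal k (f + F.d b') := by
    intro z _ _ g hg G hG
    have hGC : G ∈ F.C (k - 1) := hG.mem_C (by convert hg using 2; ring)
    rw [add_assoc]
    exact hmin _ (AddSubgroup.add_mem _ hb ⟨G, hGC, rfl⟩)
  have hle := hmin 0 (AddSubgroup.zero_mem _)
  rw [add_zero] at hle
  have hexp := h _ hC hlm (hle.trans_lt hlt)
  have hdf : F.d f = 0 := hf.2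
  rw [map_add, d_d, add_zero, hdf, norm_zero] at hexp
  have h0 := F.eq_zero_of_norm hX (f := f + F.d b') (by nlinarith)
  apply hfB
  rw [eq_neg_of_add_eq_zero_left h0]
  exact AddSubgroup.neg_mem _ hb

/-- Norms in a fixed degree are multiples of one quantum, so strict decrease means decrease by at
least that quantum. -/
lemma exists_nat_norm {n : ℕ} (hX : X.IsPureCard n) {j : ℕ} {g : F.Cochain} (hg : g ∈ F.C j) :
    ∃ a : ℕ, F.norm g = a * (((n.choose (j + 1) : ℕ) : ℝ)⁻¹ * (X.facets.card : ℝ)⁻¹) := by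
  refine ⟨∑ x ∈ F.support g, (X.facets.filter fun t => x ⊆ t).card, ?_⟩
  rw [norm_eq_sum_support, Nat.cast_sum, Finset.sum_mul]
  refine Finset.sum_congr rfl fun x hx => ?_
  rw [hX.wt_eq, card_of_mem_support hg x hx]
  ring

/-- All faces in the support contain a fixed vertex `v` of `z`. The `k`-faces through `v` have total
weight `k + 1` times that of `v`, which the degree bounds. -/
lemma norm_le_of_degree_le {n Q k : ℕ} (hX : X.IsPureCard n) (hk : k + 1 ≤ n)
    (hQ : X.degree ≤ Q) {z : X.Face} (hz : 0 < z.1.card) {G : F.Cochain} (hG : G ∈ F.C k)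
    (hsupp : ∀ y : X.Face, ¬ z.1 ⊆ y.1 → G y = 0) :
    F.norm G ≤ ((k : ℝ) + 1) * Q / (n * X.facets.card) := by
  obtain ⟨v, hv⟩ := Finset.card_pos.mp hz
  have hvz : ({v} : Finset V) ⊆ z.1 := Finset.singleton_subset_iff.mpr hv
  have hvX : {v} ∈ X.faces := X.down_closed z.2 hvz
  have h1 : F.norm G ≤ ∑ x ∈ X.faces with x.card = k + 1 ∧ {v} ⊆ x, X.wt x := by
    rw [norm_eq_sum_support]
    refine Finset.sum_le_sum_of_subset_of_nonneg ?_ fun x _ _ => X.wt_nonneg x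
    intro x hx
    have hxX := support_subset G hx
    refine Finset.mem_filter.mpr ⟨hxX, card_of_mem_support hG x hx, hvz.trans ?_⟩
    by_contra hzx
    exact (mem_support (x := ⟨x, hxX⟩)).mp hx (hsupp ⟨x, hxX⟩ hzx)
  have h2 : (X.facets.filter fun t => {v} ⊆ t).card ≤ Q := by
    rw [← card_cells_dim_filter]
    refine le_trans ?_ hQ
    exact Finset.le_sup (s := X.cells 0)
      (f := fun x => ((X.cells X.dim).filter fun y => x.1 ⊆ y.1).card) (b := ⟨{v}, hvX⟩)
      (mem_cells_int.mpr (by simp))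
  rw [hX.sum_wt {v} (by simp) hk, hX.wt_eq, Finset.card_singleton, Nat.choose_one_right,
    Nat.choose_one_right] at h1
  refine h1.trans ?_
  have h3 : ((X.facets.filter fun t => {v} ⊆ t).card : ℝ) ≤ Q := by exact_mod_cast h2
  calc ((k + 1 : ℕ) : ℝ) * ((n : ℝ)⁻¹ * (X.facets.card : ℝ)⁻¹ *
        ((X.facets.filter fun t => {v} ⊆ t).card : ℝ))
      ≤ ((k + 1 : ℕ) : ℝ) * ((n : ℝ)⁻¹ * (X.facets.card : ℝ)⁻¹ * Q) := by gcongr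
    _ = _ := by push_cast; rw [div_eq_mul_inv, mul_inv]; ring

/-- A cochain can be made locally minimal by adding the coboundary of a small cochain. -/
lemma exists_isLocallyMinimal {n Q k : ℕ} (hX : X.IsPureCard n) (hk : k + 2 ≤ n)
    (hQ : X.degree ≤ Q) (a : ℕ) (g : F.Cochain) (hg : g ∈ F.C ((k + 1 : ℕ) : ℤ))
    (ha : F.norm g = a * (((n.choose (k + 2) : ℕ) : ℝ)⁻¹ * (X.facets.card : ℝ)⁻¹)) :
    ∃ h ∈ F.C k, F.IsLocallyMinimal ((k + 1 : ℕ) : ℤ) (g + F.d h) ∧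
      F.norm (g + F.d h) ≤ F.norm g ∧
      F.norm h ≤ a * (((k : ℝ) + 1) * Q / (n * X.facets.card)) := by
  induction a using Nat.strong_induction_on generalizing g with
  | _ a ih =>
    by_cases hlm : F.IsLocallyMinimal ((k + 1 : ℕ) : ℤ) g
    · refine ⟨0, AddSubgroup.zero_mem _, ?_, ?_, ?_⟩
      · rwa [map_zero, add_zero]
      · rw [map_zero, add_zero]
      · rw [norm_zero]; positivity
    unfold IsLocallyMinimal IsLocallyMinimalAt at hlm
    push Not at hlm
    obtain ⟨z, hz0, hzk, g0, hg0, G, hG, hlt⟩ := hlm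
    have hGC : G ∈ F.C k := hG.mem_C (by convert hg0 using 2; push_cast; ring)
    have hdG : F.d G ∈ F.C ((k + 1 : ℕ) : ℤ) := d_mem_natCast hGC
    have hg' := AddSubgroup.add_mem _ hg hdG
    obtain ⟨a', ha'⟩ := exists_nat_norm hX hg'
    have hq : (0 : ℝ) < ((n.choose (k + 2) : ℕ) : ℝ)⁻¹ * (X.facets.card : ℝ)⁻¹ := by
      have h1 : (0 : ℝ) < (n.choose (k + 2) : ℕ) := by exact_mod_cast Nat.choose_pos hk
      have h2 : (0 : ℝ) < X.facets.card := by exact_mod_cast hX.card_facets_pos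
      positivity
    -- The number of quanta drops, so at most `a` corrections are made, each of bounded norm.
    have haa : a' < a := by
      rw [ha, ha'] at hlt
      exact_mod_cast lt_of_mul_lt_mul_right hlt hq.le
    obtain ⟨h, hh, h1, h2, h3⟩ := ih a' haa _ hg' ha'
    have hadd : g + F.d G + F.d h = g + F.d (G + h) := by rw [map_add, add_assoc]
    rw [hadd] at h1 h2
    refine ⟨G + h, AddSubgroup.add_mem _ hGC hh, h1, h2.trans hlt.le, ?_⟩
    have h4 := norm_le_of_degree_le hX (by omega) hQ
      (by simp only [Face.dim] at hz0; omega) hGC hG.2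
    have h5 : (a' : ℝ) + 1 ≤ a := by exact_mod_cast haa
    have h6 : (0 : ℝ) ≤ ((k : ℝ) + 1) * Q / (n * X.facets.card) := by positivity
    refine (F.norm_add_le G h).trans ?_
    nlinarith [mul_le_mul_of_nonneg_right h5 h6]

/-- If small locally minimal `k + 1`-cochains expand, then `k`-cochains expand relative to the
cocycles. -/
lemma Expands.quotNorm_Z_le {n Q k : ℕ} (hX : X.IsPureCard n) (hk : k + 2 ≤ n)
    (hQ : X.degree ≤ Q) {β α : ℝ} (hβ : 0 < β) (hα : 0 ≤ α)
    (h : F.Expands ((k + 1 : ℕ) : ℤ) β α) {f : F.Cochain} (hf : f ∈ F.C k) :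
    min α ((n : ℝ) / (((k : ℝ) + 1) * Q) * ((n.choose (k + 2) : ℕ) : ℝ)⁻¹) *
      F.quotNorm (F.Z k) f ≤ F.norm (F.d f) := by
  have hq0 : 0 ≤ F.quotNorm (F.Z k) f := F.le_quotNorm fun g _ => F.norm_nonneg _
  have hdf : F.d f ∈ F.C ((k + 1 : ℕ) : ℤ) := d_mem_natCast hf
  -- If `d f` is large, it suffices that norms are at most `1`.
  rcases le_or_gt α (F.norm (F.d f)) with hle | hlt
  · have h1 := (F.quotNorm_le_norm (F.Z k) f).trans (F.norm_le_one hX (by omega) hf)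
    calc _ ≤ α * F.quotNorm (F.Z k) f := mul_le_mul_of_nonneg_right (min_le_left _ _) hq0
      _ ≤ α * 1 := mul_le_mul_of_nonneg_left h1 hα
      _ ≤ _ := by rwa [mul_one]
  obtain ⟨a, ha⟩ := exists_nat_norm hX hdf
  obtain ⟨g, hg, hlm, hle, hnorm⟩ := exists_isLocallyMinimal hX hk hQ a _ hdf ha
  have hdg : F.d g ∈ F.C ((k + 1 : ℕ) : ℤ) := d_mem_natCast hg
  have hexp := h _ (AddSubgroup.add_mem _ hdf hdg) hlm (hle.trans_lt hlt)
  rw [map_add, d_d, d_d, add_zero, norm_zero] at hexp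
  have h0 := F.eq_zero_of_norm hX (f := F.d f + F.d g) (by nlinarith)
  -- As `d f + d g` vanishes, `f + g` is a cocycle, and its distance from `f` is the norm of `g`.
  have hZ : -(f + g) ∈ F.Z k :=
    AddSubgroup.neg_mem _ ⟨AddSubgroup.add_mem _ hf hg, by rw [← map_add] at h0; exact h0⟩
  have h1 := F.quotNorm_le (f := f) hZ
  rw [show f + -(f + g) = -g by abel, norm_neg] at h1
  have hn : (0 : ℝ) < n := by exact_mod_cast (by omega : 0 < n)
  have hT : (0 : ℝ) < X.facets.card := by exact_mod_cast hX.card_facets_pos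
  have hch : (0 : ℝ) < (n.choose (k + 2) : ℕ) := by exact_mod_cast Nat.choose_pos hk
  refine (mul_le_mul_of_nonneg_right (min_le_right _ _) hq0).trans ?_
  refine (mul_le_mul_of_nonneg_left (h1.trans hnorm) (by positivity)).trans ?_
  rw [ha]
  -- For `Q = 0` the quotient by `(k + 1) * Q` is zero by convention and the bound is trivial.
  rcases Nat.eq_zero_or_pos Q with rfl | hQpos
  · simp only [Nat.cast_zero, mul_zero, div_zero, zero_mul]; positivity
  · have hQ0 : (0 : ℝ) < Q := by exact_mod_cast hQpos
    refine le_of_eq ?_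
    field_simp

end AugSheaf

/-! ### Assembly of the theorem. -/

lemma ciInf_pos_of_finite {ι : Type*} [Finite ι] [Nonempty ι] {f : ι → ℝ} (h : ∀ i, 0 < f i) :
    0 < ⨅ i, f i := by
  obtain ⟨i, hi⟩ := exists_eq_ciInf_of_finite (f := f)
  exact hi ▸ h i

/-- The spectral bound is assumed for the top exponent only but is needed at every level. For `c ≤
1` the top exponent is the strongest; for `c ≥ 1` the cap `1` suffices. -/
lemma le_pow_two_pow {m c : ℝ} (hc : 0 ≤ c) {r s : ℕ} (hrs : r ≤ s) (hm1 : m ≤ 1)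
    (hm : m ≤ c ^ (2 ^ s)) : m ≤ c ^ (2 ^ r) := by
  rcases le_total c 1 with h | h
  · exact hm.trans (pow_le_pow_of_le_one hc h (Nat.pow_le_pow_right (by norm_num) hrs))
  · exact hm1.trans (one_le_pow₀ h)

theorem mainTheorem1 {V : Type u} [LinearOrder V] (X : FinComplex V) (F : AugSheaf.{u, v} X)
    (k d Q : ℕ) (ε : Fin (k + 1) → ℝ) (ε' : Fin (k + 2) → ℝ) (lam e e' : ℝ)
    (hε : ∀ i, 0 < ε i) (hε' : ∀ i, 0 < ε' i) (hlam : 0 < lam)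
    (he : e = ⨅ i : Fin (k + 1), ((k : ℝ) + 2) * ε i / ((k : ℝ) + 1 - (i : ℕ)))
    (he' : e' = ⨅ i : Fin (k + 2), ((k : ℝ) + 3) * ε' i / ((k : ℝ) + 2 - (i : ℕ)))
    (hlam_le : lam ≤ 1 / (d : ℝ) *
      min (min ((e / (((k : ℝ) + 1) ^ 2 * 2 ^ (2 * k + 6))) ^ (2 ^ k))
        ((e' / (((k : ℝ) + 2) ^ 2 * 2 ^ (2 * k + 8))) ^ (2 ^ (k + 1)))) 1)
    (hd : k + 2 ≤ d) (hX : X.IsPure d) (hconn : X.StronglyConnected)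
    (h1 : ∀ i : Fin (k + 1), F.IsLocalCoboundaryExpander (i : ℕ) k (ε i))
    (h2 : ∀ i : Fin (k + 2), F.IsLocalCoboundaryExpander (i : ℕ) (k + 1) (ε' i))
    (h3 : X.IsLocalSpectralExpander ((d : ℤ) - 2) lam)
    (h4 : X.degree ≤ Q)
    (h5 : ∀ x ∈ X.cells k ∪ X.cells (k + 1) ∪ X.cells (k + 2), Nontrivial (F.sec x)) :
    F.Expands k (e / 2) ((e / (((k : ℝ) + 1) ^ 2 * 2 ^ (2 * k + 6))) ^ (2 ^ (k + 1) - 1)) ∧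
    F.Expands (k + 1) (e' / 2)
      ((e' / (((k : ℝ) + 2) ^ 2 * 2 ^ (2 * k + 8))) ^ (2 ^ (k + 2) - 1)) ∧
    F.IsCosystolicExpander k
      (min ((e' / (((k : ℝ) + 2) ^ 2 * 2 ^ (2 * k + 8))) ^ (2 ^ (k + 2) - 1))
        (((d : ℝ) + 1) / (((k : ℝ) + 1) * Q) * (((d + 1).choose (k + 2) : ℕ) : ℝ)⁻¹))
      ((e / (((k : ℝ) + 1) ^ 2 * 2 ^ (2 * k + 6))) ^ (2 ^ (k + 1) - 1)) := by
  have hP := hX.isPureCard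
  have hepos : 0 < e := he ▸ ciInf_pos_of_finite fun i => by
    have hi : ((i : ℕ) : ℝ) + 1 ≤ (k : ℝ) + 1 := by exact_mod_cast i.2
    have := hε i
    exact div_pos (by positivity) (by linarith)
  have hepos' : 0 < e' := he' ▸ ciInf_pos_of_finite fun i => by
    have hi : ((i : ℕ) : ℝ) + 1 ≤ (k : ℝ) + 2 := by exact_mod_cast i.2
    have := hε' i
    exact div_pos (by positivity) (by linarith)
  set c := e / (((k : ℝ) + 1) ^ 2 * 2 ^ (2 * k + 6)) with hc
  set c' := e' / (((k : ℝ) + 2) ^ 2 * 2 ^ (2 * k + 8)) with hc'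
  have hcpos : 0 < c := by positivity
  have hcpos' : 0 < c' := by positivity
  set m := min (min (c ^ (2 ^ k)) (c' ^ (2 ^ (k + 1)))) 1 with hm
  have hm0 : 0 ≤ m := by positivity
  have hm1 : m ≤ 1 := min_le_right _ _
  have hmc : m ≤ c ^ (2 ^ k) := (min_le_left _ _).trans (min_le_left _ _)
  have hmc' : m ≤ c' ^ (2 ^ (k + 1)) := (min_le_left _ _).trans (min_le_right _ _)
  have hform : ∀ z : X.Face, z.1.card + 2 ≤ d + 1 → (X.link z).FormLE m := fun z hz =>
    hP.formLE_link (by omega) hconn hlam hm1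
      (by rwa [one_div, inv_mul_eq_div] at hlam_le) h3 z (by omega)
  have hF : ∀ x : X.Face, x.1.card = k + 1 ∨ x.1.card = k + 2 ∨ x.1.card = k + 3 →
      Nontrivial (F.sec x) := by
    intro x hx
    refine h5 x ?_
    simp only [Finset.mem_union, mem_cells_int]
    omega
  have hE : F.Expands k (e / 2) (c ^ (2 ^ (k + 1) - 1)) := by
    refine AugSheaf.expands_of_link hP (by omega) hepos hm0
      (fun r hr => le_pow_two_pow hcpos.le (Nat.lt_succ_iff.mp hr) hm1 hmc) hform
      (fun x hx => hF x (by omega)) fun z j hj hz => ?_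
    refine ⟨ε ⟨j, by omega⟩, h1 ⟨j, by omega⟩ z (mem_cells.mpr hz), ?_⟩
    exact he.trans_le (ciInf_le (Set.finite_range _).bddBelow (⟨j, by omega⟩ : Fin (k + 1)))
  have hE' : F.Expands ((k + 1 : ℕ) : ℤ) (e' / 2) (c' ^ (2 ^ (k + 2) - 1)) := by
    -- The constant of (ii) is that of (i) with `k + 1` in place of `k`.
    have hcc : c' = e' / ((((k + 1 : ℕ) : ℝ) + 1) ^ 2 * 2 ^ (2 * (k + 1) + 6)) := by
      rw [hc']; push_cast; ring_nf
    rw [hcc]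
    refine AugSheaf.expands_of_link hP (by omega) hepos' hm0
      (fun r hr => hcc ▸ le_pow_two_pow hcpos'.le (Nat.lt_succ_iff.mp hr) hm1 hmc') hform
      (fun x hx => hF x (by omega)) fun z j hj hz => ?_
    refine ⟨ε' ⟨j, by omega⟩, ?_, ?_⟩
    · have := h2 ⟨j, by omega⟩ z (mem_cells.mpr hz)
      push_cast
      exact this
    · have h6 : e' ≤ ((k : ℝ) + 3) * ε' ⟨j, by omega⟩ / ((k : ℝ) + 2 - j) :=
        he'.trans_le (ciInf_le (Set.finite_range _).bddBelow (⟨j, by omega⟩ : Fin (k + 2)))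
      refine h6.trans (le_of_eq ?_)
      push_cast
      ring_nf
  refine ⟨hE, by exact_mod_cast hE', ?_, ?_⟩
  · intro f hf
    rw [AugSheaf.mass_eq_one F hP (by omega) (by push_cast; omega) fun x hx => hF x (by
        rw [mem_cells_int] at hx; omega),
      AugSheaf.mass_eq_one F hP (by omega) (by push_cast; omega) fun x hx => hF x (by
        rw [mem_cells_int] at hx; omega), mul_one, mul_one]
    have := hE'.quotNorm_Z_le hP (by omega) h4 (half_pos hepos') (by positivity) hf
    push_cast at this
    exact this
  · intro f hf hfB
    rw [AugSheaf.mass_eq_one F hP (by omega) (by push_cast; omega) fun x hx => hF x (by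
      rw [mem_cells_int] at hx; omega), mul_one]
    exact hE.le_norm_of_mem_Z hP (half_pos hepos) hf hfB
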